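/- Let $d\ge 1$ and $m\ge 1$ (the case of main interest is $m=3$), let $\Omega\subset\mathbb R^d$ be a bounded domain (a non-empty, connected, bounded open set), let $\alpha\in(0,1]$, and let $\varphi_1,\dots,\varphi_m:\partial\Omega\to\mathbb R$ be boundary data of class $C^{1,\alpha}$, i.e. each $\varphi_i$ is the restriction to $\partial\Omega$ of a $C^1$ function on $\mathbb R^d$ whose derivative is $\alpha$-Hölder continuous on $\overline\Omega$. Assume $$\varphi_i\ge 0\quad(i=1,\dots,m)\qquad\text{and}\qquad \prod_{i=1}^m\varphi_i=0\quad\text{on }\partial\Omega .$$ Consider the Dirichlet energy $$E(u_1,\dots,u_m)=\int_\Omega\sum_{i=1}^m|\nabla u_i|^2\,dx$$ on the constraint set $$S=\Big\{(u_1,\dots,u_m)\in H^1(\Omega)^m:\ u_i\ge 0\ \text{a.e. in }\Omega,\ \ \prod_{i=1}^m u_i=0\ \text{a.e. in }\Omega,\ \ u_i|_{\partial\Omega}=\varphi_i\Big\},$$ where $u_i|_{\partial\Omega}=\varphi_i$ means that $u_i-\Phi_i\in H^1_0(\Omega)$ for some Lipschitz function $\Phi_i:\mathbb R^d\to\mathbb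 R$ with $\Phi_i=\varphi_i$ on $\partial\Omega$ (the condition does not depend on the choice of $\Phi_i$), and $H^1_0(\Omega)$ is the closure of $C_c^\infty(\Omega)$ in $H^1(\Omega)$. Then $E$ has at least one minimizer over $S$: there is $U\in S$ with $E(U)\le E(V)$ for all $V\in S$ (in particular $S\neq\emptyset$). -/

import Mathlib

open MeasureTheory
open scoped ContDiff NNReal

noncomputable section

namespace PartialSegregation

/-- A test function on `Ω`: a member of `C_c^∞(Ω)`. -/
def IsTestFunction {d : ℕ} (Ω : Set (EuclideanSpace ℝ (Fin d)))
    (ψ : EuclideanSpace ℝ (Fin d) → ℝ) : Prop :=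
  ContDiff ℝ ∞ ψ ∧ HasCompactSupport ψ ∧ tsupport ψ ⊆ Ω

/-- `g ∈ L²(Ω; ℝ^d)` is the weak gradient of `u ∈ L²(Ω)`:
`∫_Ω u ∂_v ψ = - ∫_Ω ⟨g, v⟩ ψ` for all test functions `ψ` and all directions `v`. -/
def HasWeakGradient {d : ℕ} (Ω : Set (EuclideanSpace ℝ (Fin d)))
    (u : Lp ℝ 2 (volume.restrict Ω))
    (g : Lp (EuclideanSpace ℝ (Fin d)) 2 (volume.restrict Ω)) : Prop :=
  ∀ ψ : EuclideanSpace ℝ (Fin d) → ℝ, IsTestFunction Ω ψ → ∀ v : EuclideanSpace ℝ (Fin d),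
    ∫ x in Ω, u x * fderiv ℝ ψ x v = - ∫ x in Ω, inner ℝ (g x) v * ψ x

section IntegrabilityFacts

variable {d : ℕ} {Ω : Set (EuclideanSpace ℝ (Fin d))} {ψ : EuclideanSpace ℝ (Fin d) → ℝ}

theorem IsTestFunction.memLp (h : IsTestFunction Ω ψ) : MemLp ψ 2 (volume.restrict Ω) :=
  (h.1.continuous.memLp_of_hasCompactSupport h.2.1).restrict Ω

theorem IsTestFunction.memLp_fderiv (h : IsTestFunction Ω ψ) (v : EuclideanSpace ℝ (Fin d)) :
    MemLp (fun x => fderiv ℝ ψ x v) 2 (volume.restrict Ω) := by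
  have hc : Continuous (fun x => fderiv ℝ ψ x v) :=
    (h.1.continuous_fderiv (by simp)).clm_apply continuous_const
  have hs : HasCompactSupport (fun x => fderiv ℝ ψ x v) := h.2.1.fderiv_apply ℝ v
  exact (hc.memLp_of_hasCompactSupport hs).restrict Ω

theorem IsTestFunction.integrable_left (h : IsTestFunction Ω ψ)
    (u : Lp ℝ 2 (volume.restrict Ω)) (v : EuclideanSpace ℝ (Fin d)) :
    Integrable (fun x => u x * fderiv ℝ ψ x v) (volume.restrict Ω) :=
  (Lp.memLp u).integrable_mul (h.memLp_fderiv v)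

theorem IsTestFunction.integrable_right (h : IsTestFunction Ω ψ)
    (g : Lp (EuclideanSpace ℝ (Fin d)) 2 (volume.restrict Ω)) (v : EuclideanSpace ℝ (Fin d)) :
    Integrable (fun x => inner ℝ (g x) v * ψ x) (volume.restrict Ω) :=
  ((Lp.memLp g).inner_const v).integrable_mul h.memLp

end IntegrabilityFacts

/-- The Sobolev space `H¹(Ω)`: all `u ∈ L²(Ω)` with a weak gradient in `L²(Ω; ℝ^d)`. An element is
stored with its weak gradient (which `u` determines) as a pair `(u, ∇u)`, so that the norm inherited
from the `ℓ²`-product is the `H¹` norm `(‖u‖² + ‖∇u‖²)^{1/2}`. -/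
def H1 {d : ℕ} (Ω : Set (EuclideanSpace ℝ (Fin d))) :
    Submodule ℝ (WithLp 2 (Lp ℝ 2 (volume.restrict Ω) ×
      Lp (EuclideanSpace ℝ (Fin d)) 2 (volume.restrict Ω))) where
  carrier := {w | HasWeakGradient Ω w.fst w.snd}
  zero_mem' := by
    intro ψ _ v
    have h1 : ∫ x in Ω, (0 : Lp ℝ 2 (volume.restrict Ω)) x * fderiv ℝ ψ x v = 0 := by
      refine integral_eq_zero_of_ae ?_
      filter_upwards [Lp.coeFn_zero ℝ 2 (volume.restrict Ω)] with x hx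
      rw [hx, Pi.zero_apply, zero_mul]
    have h2 : ∫ x in Ω, inner ℝ ((0 : Lp (EuclideanSpace ℝ (Fin d)) 2 (volume.restrict Ω)) x) v
        * ψ x = 0 := by
      refine integral_eq_zero_of_ae ?_
      filter_upwards [Lp.coeFn_zero (EuclideanSpace ℝ (Fin d)) 2 (volume.restrict Ω)] with x hx
      rw [hx, Pi.zero_apply, inner_zero_left, zero_mul, Pi.zero_apply]
    simp only [WithLp.zero_fst, WithLp.zero_snd]
    rw [h1, h2, neg_zero]
  add_mem' := by
    intro a b ha hb ψ hψ v
    have h1 : ∫ x in Ω, (a.fst + b.fst : Lp ℝ 2 (volume.restrict Ω)) x * fderiv ℝ ψ x v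
        = (∫ x in Ω, a.fst x * fderiv ℝ ψ x v) + ∫ x in Ω, b.fst x * fderiv ℝ ψ x v := by
      rw [← integral_add (hψ.integrable_left a.fst v) (hψ.integrable_left b.fst v)]
      refine integral_congr_ae ?_
      filter_upwards [Lp.coeFn_add a.fst b.fst] with x hx
      rw [hx, Pi.add_apply, add_mul]
    have h2 : ∫ x in Ω, inner ℝ ((a.snd + b.snd :
          Lp (EuclideanSpace ℝ (Fin d)) 2 (volume.restrict Ω)) x) v * ψ x
        = (∫ x in Ω, inner ℝ (a.snd x) v * ψ x) + ∫ x in Ω, inner ℝ (b.snd x) v * ψ x := by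
      rw [← integral_add (hψ.integrable_right a.snd v) (hψ.integrable_right b.snd v)]
      refine integral_congr_ae ?_
      filter_upwards [Lp.coeFn_add a.snd b.snd] with x hx
      rw [hx, Pi.add_apply, inner_add_left, add_mul]
    have ha' := ha ψ hψ v
    have hb' := hb ψ hψ v
    simp only [WithLp.add_fst, WithLp.add_snd]
    rw [h1, h2, ha', hb', neg_add]
  smul_mem' := by
    intro c a ha ψ hψ v
    have h1 : ∫ x in Ω, (c • a.fst : Lp ℝ 2 (volume.restrict Ω)) x * fderiv ℝ ψ x v
        = c * ∫ x in Ω, a.fst x * fderiv ℝ ψ x v := by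
      rw [← integral_const_mul]
      refine integral_congr_ae ?_
      filter_upwards [Lp.coeFn_smul c a.fst] with x hx
      rw [hx, Pi.smul_apply, smul_eq_mul, mul_assoc]
    have h2 : ∫ x in Ω, inner ℝ ((c • a.snd :
          Lp (EuclideanSpace ℝ (Fin d)) 2 (volume.restrict Ω)) x) v * ψ x
        = c * ∫ x in Ω, inner ℝ (a.snd x) v * ψ x := by
      rw [← integral_const_mul]
      refine integral_congr_ae ?_
      filter_upwards [Lp.coeFn_smul c a.snd] with x hx
      rw [hx, Pi.smul_apply, real_inner_smul_left, mul_assoc]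
    have ha' := ha ψ hψ v
    simp only [WithLp.smul_fst, WithLp.smul_snd]
    rw [h1, h2, ha', mul_neg]

/-- The function underlying an element of `H¹(Ω)`. -/
def toL2 {d : ℕ} {Ω : Set (EuclideanSpace ℝ (Fin d))} (u : H1 Ω) :
    Lp ℝ 2 (volume.restrict Ω) :=
  (u : WithLp 2 (Lp ℝ 2 (volume.restrict Ω) ×
    Lp (EuclideanSpace ℝ (Fin d)) 2 (volume.restrict Ω))).fst

/-- The weak gradient of an element of `H¹(Ω)`. -/
def weakGrad {d : ℕ} {Ω : Set (EuclideanSpace ℝ (Fin d))} (u : H1 Ω) :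
    Lp (EuclideanSpace ℝ (Fin d)) 2 (volume.restrict Ω) :=
  (u : WithLp 2 (Lp ℝ 2 (volume.restrict Ω) ×
    Lp (EuclideanSpace ℝ (Fin d)) 2 (volume.restrict Ω))).snd

/-- `H¹₀(Ω)`: the closure of `C_c^∞(Ω)` in the `H¹` norm. -/
def H10 {d : ℕ} (Ω : Set (EuclideanSpace ℝ (Fin d))) : Set (H1 Ω) :=
  closure {w : H1 Ω | ∃ ψ, IsTestFunction Ω ψ ∧ toL2 w =ᵐ[volume.restrict Ω] ψ}

/-- `u = φ` on `∂Ω` in the sense of traces, for Lipschitz boundary data `φ` (only the values of `φ`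
on `∂Ω` matter) and an arbitrary bounded open set `Ω`: `u - Φ ∈ H¹₀(Ω)` for a Lipschitz extension
`Φ` of `φ|_∂Ω`. The choice of `Φ` is immaterial: two such extensions differ on `Ω` by a Lipschitz
function vanishing on `∂Ω`, hence by an element of `H¹₀(Ω)`. -/
def HasBoundaryValues {d : ℕ} (Ω : Set (EuclideanSpace ℝ (Fin d))) (u : H1 Ω)
    (φ : EuclideanSpace ℝ (Fin d) → ℝ) : Prop :=
  ∃ Φ : EuclideanSpace ℝ (Fin d) → ℝ, (∃ K : ℝ≥0, LipschitzWith K Φ) ∧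
    Set.EqOn Φ φ (frontier Ω) ∧
    ∃ w ∈ H10 Ω, toL2 w =ᵐ[volume.restrict Ω] fun x => toL2 u x - Φ x

/-- `φ` is of class `C^{1,α}` on `∂Ω`: on `∂Ω` it agrees with a `C¹` function on `ℝ^d` whose
derivative is `α`-Hölder continuous on the closure of `Ω`. -/
def IsC1HolderBoundaryData {d : ℕ} (Ω : Set (EuclideanSpace ℝ (Fin d))) (α : ℝ≥0)
    (φ : EuclideanSpace ℝ (Fin d) → ℝ) : Prop :=
  ∃ Φ : EuclideanSpace ℝ (Fin d) → ℝ, ContDiff ℝ 1 Φ ∧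
    (∃ C : ℝ≥0, HolderOnWith C α (fderiv ℝ Φ) (closure Ω)) ∧ Set.EqOn Φ φ (frontier Ω)

/-- The constraint set
`S = {(u_1, …, u_m) : u_i ∈ H¹(Ω), u_i ≥ 0, ∏ u_i = 0 a.e. in Ω, u_i = φ_i on ∂Ω}`. -/
def constraintSet {d m : ℕ} (Ω : Set (EuclideanSpace ℝ (Fin d)))
    (φ : Fin m → EuclideanSpace ℝ (Fin d) → ℝ) : Set (Fin m → H1 Ω) :=
  {U | (∀ i, ∀ᵐ x ∂volume.restrict Ω, 0 ≤ toL2 (U i) x) ∧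
    (∀ᵐ x ∂volume.restrict Ω, ∏ i, toL2 (U i) x = 0) ∧
    ∀ i, HasBoundaryValues Ω (U i) (φ i)}

/-- The Dirichlet energy `E(u_1, …, u_m) = ∫_Ω ∑_i |∇u_i|² dx`. -/
def dirichletEnergy {d m : ℕ} (Ω : Set (EuclideanSpace ℝ (Fin d))) (U : Fin m → H1 Ω) : ℝ :=
  ∫ x in Ω, ∑ i, ‖weakGrad (U i) x‖ ^ 2

end PartialSegregation

end

/-!
The theorem is proved by the direct method of the calculus of variations.

The constraint set is not empty: the boundary data are Lipschitz, so they have nonnegative Lipschitz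
extensions `Φ i`, and the functions `Φ i - min_j Φ j` are admissible, because the minimum vanishes
on `∂Ω` and at every point one of the differences vanishes (`constraintSet_nonempty`). Lipschitz
functions lie in `H¹(Ω)` by Rademacher's theorem.

Along a minimizing sequence, the differences from the `Φ i` lie in `H¹₀(Ω)`. This uses that the
boundary condition does not depend on the extension, i.e. that a Lipschitz function vanishing on
`∂Ω` belongs to `H¹₀(Ω)` (`mem_H10_of_lipschitz`): soft thresholding makes its support compact in
`Ω`, mollification makes it smooth with the same Lipschitz constant, and a weak limit of these
approximations stays in the closed subspace `H¹₀(Ω)`. Poincaré's inequality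
(`exists_norm_le_of_mem_H10`) bounds the differences in `H¹`, so that a subsequence converges weakly
in `H¹`. The Dirichlet energy is weakly lower semicontinuous (`sum_norm_sq_le_of_weaklyTendsto`).

The segregation condition `∏ u_i = 0` is not convex and needs strong convergence in `L²`, which is
Rellich's theorem (`tendsto_toL2_of_weaklyTendsto`). Both this and Poincaré's inequality come from
the translation estimate `∫ (ψ(x + h) - ψ(x))² ≤ ‖h‖² ∫ ‖∇ψ‖²`
(`integral_sq_translate_sub_le`): a translation by more than the diameter of `Ω` separates supports,
and small translations show that `ψ` is close to its means over small balls, which depend on `ψ`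
through integrals over balls only and so converge under weak convergence.
-/

noncomputable section

namespace PartialSegregation

/-! ### Translation estimate, Poincaré and Rellich for compactly supported functions -/

section Translations

open Filter Topology

theorem sq_integral_le_integral_sq {T : Type*} [MeasurableSpace T] {ν : Measure T}
    [IsProbabilityMeasure ν] {f : T → ℝ} (hf : Integrable f ν)
    (hf2 : Integrable (fun t => f t ^ 2) ν) : (∫ t, f t ∂ν) ^ 2 ≤ ∫ t, f t ^ 2 ∂ν :=
  (even_two.convexOn_pow (𝕜 := ℝ)).map_integral_le (f := f) (continuous_pow 2).continuousOn
    isClosed_univ (by simp) hf hf2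

theorem hasCompactSupport_sq {X : Type*} [TopologicalSpace X] {ψ : X → ℝ}
    (hψs : HasCompactSupport ψ) : HasCompactSupport (fun x => ψ x ^ 2) :=
  hψs.mono fun x hx => by
    rw [Function.mem_support] at hx ⊢
    exact fun h => hx (by simp [h])

variable {E : Type*} [NormedAddCommGroup E] [InnerProductSpace ℝ E] [FiniteDimensional ℝ E]
  [MeasurableSpace E] [BorelSpace E]

theorem integrable_comp_add {T : Type*} [TopologicalSpace T] [SecondCountableTopology T]
    [MeasurableSpace T] [OpensMeasurableSpace T] (ν : Measure T)
    [IsFiniteMeasure ν] {s : T → E} (hs : Continuous s) {g : E → ℝ} (hg : Continuous g)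
    (hgs : HasCompactSupport g) :
    Integrable (fun p : E × T => g (p.1 + s p.2)) ((volume : Measure E).prod ν) := by
  have hm : AEStronglyMeasurable (fun p : E × T => g (p.1 + s p.2))
      ((volume : Measure E).prod ν) :=
    Continuous.aestronglyMeasurable (by fun_prop)
  have hi := hg.integrable_of_hasCompactSupport (μ := volume) hgs
  rw [integrable_prod_iff' hm]
  refine ⟨ae_of_all _ fun t => hi.comp_add_right (s t), ?_⟩
  have : ∀ t, ∫ x, ‖g (x + s t)‖ = ∫ x, ‖g x‖ := fun t =>
    integral_add_right_eq_self (fun x => ‖g x‖) (s t)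
  simp only [this]
  exact integrable_const _

theorem integral_integral_comp_add {T : Type*} [TopologicalSpace T] [SecondCountableTopology T]
    [MeasurableSpace T] [OpensMeasurableSpace T] (ν : Measure T)
    [IsProbabilityMeasure ν] {s : T → E} (hs : Continuous s) {g : E → ℝ} (hg : Continuous g)
    (hgs : HasCompactSupport g) :
    ∫ x, ∫ t, g (x + s t) ∂ν = ∫ x, g x := by
  rw [integral_integral_swap (f := fun x t => g (x + s t)) (integrable_comp_add ν hs hg hgs)]
  have : ∀ t, ∫ x, g (x + s t) = ∫ x, g x := fun t => integral_add_right_eq_self g (s t)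
  simp only [this]
  simp

/-- Translating a function by `h` changes it in `L²` by at most `‖h‖` times the `L²` norm of its
gradient. -/
theorem integral_sq_translate_sub_le {ψ : E → ℝ} (hψ : ContDiff ℝ 1 ψ)
    (hψs : HasCompactSupport ψ) (h : E) :
    ∫ x, (ψ (x + h) - ψ x) ^ 2 ≤ ‖h‖ ^ 2 * ∫ x, ‖fderiv ℝ ψ x‖ ^ 2 := by
  have hd : Continuous (fderiv ℝ ψ) := hψ.continuous_fderiv (by simp)
  set ν : Measure ℝ := volume.restrict (Set.Ioc (0 : ℝ) 1) with hν
  have : IsProbabilityMeasure ν := ⟨by simp [hν]⟩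
  have hfin : ∀ f : ℝ → ℝ, Continuous f → Integrable f ν := fun f hf =>
    (hf.integrableOn_Icc (a := 0) (b := 1)).mono_set Set.Ioc_subset_Icc_self
  have hs : Continuous (fun t : ℝ => t • h) := by fun_prop
  have hg : Continuous (fun x => ‖fderiv ℝ ψ x‖ ^ 2) := by fun_prop
  have hgs : HasCompactSupport (fun x => ‖fderiv ℝ ψ x‖ ^ 2) :=
    (hψs.fderiv ℝ).comp_left (g := fun L => ‖L‖ ^ 2) (by simp)
  have hpt : ∀ x, (ψ (x + h) - ψ x) ^ 2 ≤ ‖h‖ ^ 2 * ∫ t, ‖fderiv ℝ ψ (x + t • h)‖ ^ 2 ∂ν := by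
    intro x
    have hftc : ψ (x + h) - ψ x = ∫ t, fderiv ℝ ψ (x + t • h) h ∂ν := by
      rw [hν, ← intervalIntegral.integral_of_le zero_le_one,
        intervalIntegral.integral_eq_sub_of_hasDerivAt (f := fun t : ℝ => ψ (x + t • h))]
      · simp
      · intro t _
        have h1 : HasDerivAt (fun t : ℝ => x + t • h) h t := by
          simpa using ((hasDerivAt_id t).smul_const h).const_add x
        exact ((hψ.differentiable one_ne_zero _).hasFDerivAt.comp_hasDerivAt t h1)
      · exact Continuous.intervalIntegrable (by fun_prop) _ _
    rw [hftc, ← integral_const_mul]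
    refine (sq_integral_le_integral_sq (hfin _ (by fun_prop)) (hfin _ (by fun_prop))).trans ?_
    refine integral_mono (hfin _ (by fun_prop)) (hfin _ (by fun_prop)) fun t => ?_
    have := (fderiv ℝ ψ (x + t • h)).le_opNorm h
    calc _ = ‖fderiv ℝ ψ (x + t • h) h‖ ^ 2 := by simp
      _ ≤ (‖fderiv ℝ ψ (x + t • h)‖ * ‖h‖) ^ 2 := by gcongr
      _ = _ := by ring
  calc ∫ x, (ψ (x + h) - ψ x) ^ 2
      ≤ ∫ x, ‖h‖ ^ 2 * ∫ t, ‖fderiv ℝ ψ (x + t • h)‖ ^ 2 ∂ν := by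
        refine integral_mono_of_nonneg (ae_of_all _ fun x => sq_nonneg _) ?_ (ae_of_all _ hpt)
        exact ((integrable_comp_add ν hs hg hgs).integral_prod_left).const_mul _
    _ = _ := by rw [integral_const_mul, integral_integral_comp_add ν hs hg hgs]

theorem integrable_sq_of_hasCompactSupport {ψ : E → ℝ} (hψ : Continuous ψ)
    (hψs : HasCompactSupport ψ) : Integrable (fun x => ψ x ^ 2) (volume : Measure E) :=
  (hψ.pow 2).integrable_of_hasCompactSupport (hasCompactSupport_sq hψs)

/-- **Poincaré's inequality**: a translation by more than the diameter separates the supports of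
`ψ` and of its translate, so that the translation estimate controls `ψ` itself. -/
theorem integral_sq_le_of_tsupport_subset_ball [Nontrivial E] {ψ : E → ℝ} (hψ : ContDiff ℝ 1 ψ)
    (hψs : HasCompactSupport ψ) {R : ℝ} (hR : 0 ≤ R) (hsub : tsupport ψ ⊆ Metric.closedBall 0 R) :
    ∫ x, ψ x ^ 2 ≤ (2 * R + 1) ^ 2 * ∫ x, ‖fderiv ℝ ψ x‖ ^ 2 := by
  obtain ⟨h, hh⟩ := exists_norm_eq E (c := 2 * R + 1) (by positivity)
  have key := integral_sq_translate_sub_le hψ hψs h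
  rw [hh] at key
  refine le_trans ?_ key
  -- `x` and `x + h` cannot both lie in the ball, so the cross term of the square vanishes.
  have hi := integrable_sq_of_hasCompactSupport hψ.continuous hψs
  have hpt : ∀ x, (ψ (x + h) - ψ x) ^ 2 = ψ (x + h) ^ 2 + ψ x ^ 2 := by
    intro x
    have : ψ (x + h) * ψ x = 0 := by
      by_contra hne
      have h1 := hsub (subset_tsupport ψ (left_ne_zero_of_mul hne))
      have h2 := hsub (subset_tsupport ψ (right_ne_zero_of_mul hne))
      rw [mem_closedBall_zero_iff] at h1 h2
      have : ‖h‖ ≤ ‖x + h‖ + ‖x‖ := by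
        simpa using norm_sub_le (x + h) x
      linarith
    linear_combination -2 * this
  simp only [hpt]
  rw [integral_add (hi.comp_add_right h) hi, integral_add_right_eq_self (fun x => ψ x ^ 2) h]
  have : 0 ≤ ∫ x, ψ x ^ 2 := integral_nonneg fun x => sq_nonneg _
  linarith

/-- The uniform probability measure on the ball of radius `ε` about the origin. -/
def ballMeasure (E : Type*) [NormedAddCommGroup E] [InnerProductSpace ℝ E]
    [FiniteDimensional ℝ E] [MeasurableSpace E] [BorelSpace E] (ε : ℝ) : Measure E :=
  (volume (Metric.ball (0 : E) ε))⁻¹ • volume.restrict (Metric.ball (0 : E) ε)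

theorem isProbabilityMeasure_ballMeasure {ε : ℝ} (hε : 0 < ε) :
    IsProbabilityMeasure (ballMeasure E ε) := by
  refine ⟨?_⟩
  rw [ballMeasure, Measure.smul_apply, Measure.restrict_apply_univ, smul_eq_mul,
    ENNReal.inv_mul_cancel (Metric.measure_ball_pos _ _ hε).ne' measure_ball_lt_top.ne]

/-- The mean value of `ψ` over a ball as a multiple of an integral over that ball. -/
theorem integral_ballMeasure_translate (ε : ℝ) (ψ : E → ℝ) (x : E) :
    ∫ h, ψ (x + h) ∂ballMeasure E ε
      = ((volume (Metric.ball (0 : E) ε))⁻¹).toReal * ∫ y in Metric.ball x ε, ψ y := by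
  rw [ballMeasure, integral_smul_measure, smul_eq_mul]
  congr 1
  rw [← integral_indicator Metric.isOpen_ball.measurableSet,
    ← integral_indicator Metric.isOpen_ball.measurableSet,
    ← integral_add_left_eq_self (fun y => (Metric.ball x ε).indicator ψ y) x]
  congr 1
  ext h
  simp [Set.indicator, Metric.mem_ball, dist_eq_norm]

theorem ae_ballMeasure_norm_le (ε : ℝ) : ∀ᵐ h ∂ballMeasure E ε, ‖h‖ ≤ ε := by
  refine Measure.ae_smul_measure ?_ _
  filter_upwards [ae_restrict_mem Metric.isOpen_ball.measurableSet] with h hh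
  exact (mem_ball_zero_iff.1 hh).le

/-- A function is close in `L²` to its means over small balls, in terms of its gradient. -/
theorem integral_sq_sub_ball_mean_le {ψ : E → ℝ} (hψ : ContDiff ℝ 1 ψ)
    (hψs : HasCompactSupport ψ) {ε : ℝ} (hε : 0 < ε) :
    Integrable (fun x => (ψ x - ∫ h, ψ (x + h) ∂ballMeasure E ε) ^ 2) ∧
    ∫ x, (ψ x - ∫ h, ψ (x + h) ∂ballMeasure E ε) ^ 2 ≤ ε ^ 2 * ∫ x, ‖fderiv ℝ ψ x‖ ^ 2 := by
  have := isProbabilityMeasure_ballMeasure (E := E) hε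
  set ρ := ballMeasure E ε
  have hc := hψ.continuous
  have hi := integrable_sq_of_hasCompactSupport hc hψs
  obtain ⟨C, hC⟩ := hc.bounded_above_of_compact_support hψs
  have hbd : ∀ f : E → ℝ, Continuous f → (∃ C, ∀ x, ‖f x‖ ≤ C) → Integrable f ρ :=
    fun f hf ⟨C, hC⟩ => Integrable.of_bound hf.aestronglyMeasurable C (ae_of_all _ hC)
  have hint : ∀ x, Integrable (fun h => ψ (x + h)) ρ := fun x =>
    hbd _ (by fun_prop) ⟨C, fun h => hC _⟩
  have hint2 : ∀ x, Integrable (fun h => (ψ (x + h) - ψ x) ^ 2) ρ := fun x => by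
    refine hbd _ (by fun_prop) ⟨(C + C) ^ 2, fun h => ?_⟩
    rw [norm_pow]
    gcongr
    exact (norm_sub_le _ _).trans (add_le_add (hC _) (hC _))
  have hprod : Integrable (fun p : E × E => (ψ (p.1 + p.2) - ψ p.1) ^ 2)
      ((volume : Measure E).prod ρ) := by
    have h1 := integrable_comp_add (g := fun x => ψ x ^ 2) ρ continuous_id (hc.pow 2)
      (hasCompactSupport_sq hψs)
    have h2 : Integrable (fun p : E × E => ψ p.1 ^ 2) ((volume : Measure E).prod ρ) :=
      hi.comp_fst ρ
    refine ((h1.const_mul 2).add (h2.const_mul 2)).mono'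
      (Continuous.aestronglyMeasurable (by fun_prop)) (ae_of_all _ fun p => ?_)
    rw [Real.norm_of_nonneg (sq_nonneg _)]
    simp only [Pi.add_apply, id]
    nlinarith [sq_nonneg (ψ (p.1 + p.2) + ψ p.1)]
  have hpt : ∀ x, (ψ x - ∫ h, ψ (x + h) ∂ρ) ^ 2 ≤ ∫ h, (ψ (x + h) - ψ x) ^ 2 ∂ρ := by
    intro x
    have h1 : ∫ h, (ψ (x + h) - ψ x) ∂ρ = (∫ h, ψ (x + h) ∂ρ) - ψ x := by
      rw [integral_sub (hint x) (integrable_const _)]; simp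
    rw [← neg_sq, neg_sub, ← h1]
    exact sq_integral_le_integral_sq ((hint x).sub (integrable_const _)) (hint2 x)
  have hmeas : AEStronglyMeasurable (fun x => (ψ x - ∫ h, ψ (x + h) ∂ρ) ^ 2)
      (volume : Measure E) := by
    have : StronglyMeasurable (fun x => ∫ h, ψ (x + h) ∂ρ) :=
      StronglyMeasurable.integral_prod_right' (f := fun p : E × E => ψ (p.1 + p.2))
        (Continuous.stronglyMeasurable (by fun_prop))
    exact ((hc.stronglyMeasurable.sub this).pow 2).aestronglyMeasurable
  have hdom := hprod.integral_prod_left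
  refine ⟨hdom.mono' hmeas (ae_of_all _ fun x => ?_), ?_⟩
  · rw [Real.norm_of_nonneg (sq_nonneg _)]; exact hpt x
  calc _ ≤ ∫ x, ∫ h, (ψ (x + h) - ψ x) ^ 2 ∂ρ :=
        integral_mono_of_nonneg (ae_of_all _ fun x => sq_nonneg _) hdom (ae_of_all _ hpt)
    _ = ∫ h, (∫ x, (ψ (x + h) - ψ x) ^ 2) ∂ρ :=
        integral_integral_swap (f := fun x h => (ψ (x + h) - ψ x) ^ 2) hprod
    _ ≤ ∫ h, (ε ^ 2 * ∫ x, ‖fderiv ℝ ψ x‖ ^ 2) ∂ρ := by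
        refine integral_mono_ae hprod.integral_prod_right (integrable_const _) ?_
        filter_upwards [ae_ballMeasure_norm_le (E := E) ε] with h hh
        refine (integral_sq_translate_sub_le hψ hψs h).trans ?_
        gcongr
    _ = _ := by simp

/-- **Rellich's theorem** for compactly supported functions: if the integrals over balls tend to
`0`, then the means over balls of a fixed small radius tend to `0` boundedly, hence in `L²(Ω)`,
and the functions differ from these means by little, uniformly along the sequence. -/
theorem tendsto_integral_sq_of_tendsto_ball {Ω : Set E}
    (hΩ : volume Ω ≠ ⊤) {ψ : ℕ → E → ℝ}
    (hψ : ∀ n, ContDiff ℝ 1 (ψ n)) (hψs : ∀ n, HasCompactSupport (ψ n))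
    (hsub : ∀ n, tsupport (ψ n) ⊆ Ω) {C : ℝ} (hC : ∀ n, ∫ x, ψ n x ^ 2 ≤ C)
    (hC' : ∀ n, ∫ x, ‖fderiv ℝ (ψ n) x‖ ^ 2 ≤ C)
    (hlim : ∀ x ε, Tendsto (fun n => ∫ y in Metric.ball x ε, ψ n y) atTop (𝓝 0)) :
    Tendsto (fun n => ∫ x, ψ n x ^ 2) atTop (𝓝 0) := by
  have hC0 : 0 ≤ C := (integral_nonneg fun x => sq_nonneg _).trans (hC 0)
  have hvol : Fact (volume Ω < ⊤) := ⟨lt_top_iff_ne_top.2 hΩ⟩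
  have hmean : ∀ ε : ℝ, 0 < ε →
      Tendsto (fun n => ∫ x in Ω, (∫ h, ψ n (x + h) ∂ballMeasure E ε) ^ 2) atTop (𝓝 0) := by
    intro ε hε
    have := isProbabilityMeasure_ballMeasure (E := E) hε
    set c := ((volume (Metric.ball (0 : E) ε))⁻¹).toReal with hc
    have hmeas : ∀ n, StronglyMeasurable (fun x => ∫ h, ψ n (x + h) ∂ballMeasure E ε) := by
      intro n
      have := (hψ n).continuous
      exact StronglyMeasurable.integral_prod_right' (f := fun p : E × E => ψ n (p.1 + p.2))
        (Continuous.stronglyMeasurable (by fun_prop))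
    have := tendsto_integral_of_dominated_convergence (μ := volume.restrict Ω)
      (F := fun n x => (∫ h, ψ n (x + h) ∂ballMeasure E ε) ^ 2) (f := fun _ => 0)
      (fun _ => c * C) (fun n => ((hmeas n).pow 2).aestronglyMeasurable) (integrable_const _)
      (fun n => ae_of_all _ fun x => ?_) (ae_of_all _ fun x => ?_)
    · simpa using this
    · have hcn := (hψ n).continuous
      obtain ⟨M, hM⟩ := hcn.bounded_above_of_compact_support (hψs n)
      rw [Real.norm_of_nonneg (sq_nonneg _)]
      refine (sq_integral_le_integral_sq ?_ ?_).trans ?_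
      · exact Integrable.of_bound (Continuous.aestronglyMeasurable (by fun_prop)) M
          (ae_of_all _ fun h => hM _)
      · refine Integrable.of_bound (Continuous.aestronglyMeasurable (by fun_prop)) (M ^ 2)
          (ae_of_all _ fun h => ?_)
        rw [norm_pow]
        gcongr
        exact hM _
      · rw [integral_ballMeasure_translate ε (fun y => ψ n y ^ 2) x]
        refine mul_le_mul_of_nonneg_left ?_ ENNReal.toReal_nonneg
        exact (setIntegral_le_integral (integrable_sq_of_hasCompactSupport hcn (hψs n))
          (ae_of_all _ fun x => sq_nonneg _)).trans (hC n)
    · simp only [integral_ballMeasure_translate]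
      have := ((hlim x ε).const_mul c).pow 2
      rw [mul_zero, zero_pow two_ne_zero] at this
      exact this
  have hle : ∀ ε : ℝ, 0 < ε → ∀ n, ∫ x, ψ n x ^ 2 ≤
      2 * (ε ^ 2 * C) + 2 * ∫ x in Ω, (∫ h, ψ n (x + h) ∂ballMeasure E ε) ^ 2 := by
    intro ε hε n
    have := isProbabilityMeasure_ballMeasure (E := E) hε
    have hcn := (hψ n).continuous
    obtain ⟨hi, hle⟩ := integral_sq_sub_ball_mean_le (hψ n) (hψs n) hε
    have hi2 := integrable_sq_of_hasCompactSupport hcn (hψs n)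
    set A : E → ℝ := fun x => ∫ h, ψ n (x + h) ∂ballMeasure E ε with hA
    have hAi : Integrable (fun x => A x ^ 2) := by
      have hm : StronglyMeasurable A :=
        StronglyMeasurable.integral_prod_right' (f := fun p : E × E => ψ n (p.1 + p.2))
          (Continuous.stronglyMeasurable (by fun_prop))
      refine ((hi.const_mul 2).add (hi2.const_mul 2)).mono' (hm.pow 2).aestronglyMeasurable
        (ae_of_all _ fun x => ?_)
      rw [Real.norm_of_nonneg (sq_nonneg _)]
      simp only [Pi.add_apply]
      change A x ^ 2 ≤ 2 * (ψ n x - A x) ^ 2 + 2 * ψ n x ^ 2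
      nlinarith [sq_nonneg (2 * ψ n x - A x)]
    have hΩeq : ∫ x in Ω, ψ n x ^ 2 = ∫ x, ψ n x ^ 2 := by
      refine setIntegral_eq_integral_of_forall_compl_eq_zero fun x hx => ?_
      rw [image_eq_zero_of_notMem_tsupport fun h => hx (hsub n h)]; simp
    calc ∫ x, ψ n x ^ 2 = ∫ x in Ω, ψ n x ^ 2 := hΩeq.symm
      _ ≤ ∫ x in Ω, (2 * (ψ n x - A x) ^ 2 + 2 * A x ^ 2) := by
        refine integral_mono hi2.restrict
          (((hi.const_mul 2).add (hAi.const_mul 2)).restrict) fun x => ?_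
        change ψ n x ^ 2 ≤ 2 * (ψ n x - A x) ^ 2 + 2 * A x ^ 2
        nlinarith [sq_nonneg (ψ n x - 2 * A x)]
      _ = 2 * (∫ x in Ω, (ψ n x - A x) ^ 2) + 2 * ∫ x in Ω, A x ^ 2 := by
        rw [integral_add (hi.const_mul 2).restrict (hAi.const_mul 2).restrict,
          integral_const_mul, integral_const_mul]
      _ ≤ _ := by
        gcongr
        refine (setIntegral_le_integral hi (ae_of_all _ fun x => sq_nonneg _)).trans
          (hle.trans ?_)
        gcongr
        exact hC' n
  rw [Metric.tendsto_atTop]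
  intro δ hδ
  -- This radius makes the gradient term of `hle` at most `δ / 4`.
  set ε := Real.sqrt (δ / (8 * (C + 1))) with hε
  have hεpos : 0 < ε := Real.sqrt_pos.2 (by positivity)
  have hε2 : 2 * (ε ^ 2 * C) ≤ δ / 4 := by
    rw [hε, Real.sq_sqrt (by positivity)]
    rw [div_mul_eq_mul_div, ← mul_div_assoc, div_le_div_iff₀ (by positivity) (by norm_num)]
    nlinarith
  obtain ⟨N, hN⟩ := (Metric.tendsto_atTop.1 (hmean ε hεpos)) (δ / 4) (by positivity)
  refine ⟨N, fun n hn => ?_⟩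
  have h1 := hN n hn
  have h2 := hle ε hεpos n
  rw [Real.dist_eq, sub_zero] at h1 ⊢
  rw [abs_of_nonneg (integral_nonneg fun x => sq_nonneg _)]
  have := le_abs_self (∫ x in Ω, (∫ h, ψ n (x + h) ∂ballMeasure E ε) ^ 2)
  linarith

end Translations

/-! ### Weak convergence of sequences in Hilbert spaces -/

section WeakConvergence

open Filter Topology

variable {X : Type*} [NormedAddCommGroup X] [InnerProductSpace ℝ X]

/-- Weak convergence of a sequence in a real inner product space. -/
def WeaklyTendsto (x : ℕ → X) (a : X) : Prop :=
  ∀ y, Tendsto (fun n => inner ℝ (x n) y) atTop (𝓝 (inner ℝ a y))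

/-- Bounded sequences of a separable Hilbert space have weakly convergent subsequences: this is
the sequential Banach–Alaoglu theorem, transported along the Riesz isometry. -/
theorem exists_subseq_weaklyTendsto [CompleteSpace X] [TopologicalSpace.SeparableSpace X]
    {x : ℕ → X} {C : ℝ} (hx : ∀ n, ‖x n‖ ≤ C) :
    ∃ a, ∃ k : ℕ → ℕ, StrictMono k ∧ WeaklyTendsto (x ∘ k) a := by
  obtain ⟨F, -, k, hk, hF⟩ := WeakDual.isSeqCompact_closedBall ℝ X 0 C
    (x := fun n => StrongDual.toWeakDual (InnerProductSpace.toDual ℝ X (x n))) (fun n => by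
      simpa using hx n)
  refine ⟨(InnerProductSpace.toDual ℝ X).symm (WeakDual.toStrongDual F), k, hk, fun y => ?_⟩
  have := ((WeakDual.eval_continuous y).tendsto F).comp hF
  rw [InnerProductSpace.toDual_symm_apply]
  exact this

theorem WeaklyTendsto.map {Y : Type*} [NormedAddCommGroup Y] [InnerProductSpace ℝ Y]
    [CompleteSpace X] [CompleteSpace Y] {x : ℕ → X} {a : X} (h : WeaklyTendsto x a)
    (T : X →L[ℝ] Y) : WeaklyTendsto (fun n => T (x n)) (T a) := fun y => by
  simpa only [ContinuousLinearMap.adjoint_inner_right] using h (T.adjoint y)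

theorem WeaklyTendsto.sub_const {x : ℕ → X} {a : X} (h : WeaklyTendsto x a) (b : X) :
    WeaklyTendsto (fun n => x n - b) (a - b) := fun y => by
  simpa only [inner_sub_left] using (h y).sub_const (inner ℝ b y)

theorem weaklyTendsto_of_tendsto {x : ℕ → X} {a : X} (h : Tendsto x atTop (𝓝 a)) :
    WeaklyTendsto x a := fun _ => h.inner tendsto_const_nhds

theorem WeaklyTendsto.unique {x : ℕ → X} {a b : X} (ha : WeaklyTendsto x a)
    (hb : WeaklyTendsto x b) : a = b :=
  ext_inner_right ℝ fun y => tendsto_nhds_unique (ha y) (hb y)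

theorem WeaklyTendsto.comp {x : ℕ → X} {a : X} (h : WeaklyTendsto x a) {k : ℕ → ℕ}
    (hk : StrictMono k) : WeaklyTendsto (x ∘ k) a := fun y => (h y).comp hk.tendsto_atTop

/-- Closed subspaces are weakly sequentially closed. -/
theorem WeaklyTendsto.mem_of_isClosed [CompleteSpace X] {x : ℕ → X} {a : X}
    (h : WeaklyTendsto x a) {M : Submodule ℝ X} (hM : IsClosed (M : Set X))
    (hx : ∀ n, x n ∈ M) : a ∈ M := by
  have : CompleteSpace M := hM.completeSpace_coe
  rw [← M.orthogonal_orthogonal, Submodule.mem_orthogonal']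
  intro y hy
  have h0 : ∀ n, inner ℝ (x n) y = 0 := fun n => (Submodule.mem_orthogonal M y).1 hy _ (hx n)
  have := h y
  simp only [h0] at this
  exact (tendsto_nhds_unique this tendsto_const_nhds)

/-- A bounded sequence in the closure of a subspace `S`, weakly convergent to `a`, is up to a
null sequence the translate by `a` of a bounded sequence in `S` that tends weakly to `0`. -/
theorem WeaklyTendsto.exists_approx [CompleteSpace X] {w : ℕ → X} {a : X}
    (h : WeaklyTendsto w a) {S : Submodule ℝ X} (hw : ∀ n, w n ∈ S.topologicalClosure)
    {C : ℝ} (hC : ∀ n, ‖w n‖ ≤ C) :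
    ∃ z : ℕ → X, (∀ n, z n ∈ S) ∧ Tendsto (fun n => w n - a - z n) atTop (𝓝 0) ∧
      WeaklyTendsto z 0 ∧ ∃ C', ∀ n, ‖z n‖ ≤ C' := by
  have ha : a ∈ S.topologicalClosure := h.mem_of_isClosed S.isClosed_topologicalClosure hw
  have happ : ∀ n : ℕ, ∃ z, z ∈ S ∧ dist (w n - a) z < 1 / ((n : ℝ) + 1) :=
    fun n => Metric.mem_closure_iff.1 (S.topologicalClosure.sub_mem (hw n) ha) _ (by positivity)
  choose z hz hdist using happ
  have hlim : Tendsto (fun n => w n - a - z n) atTop (𝓝 0) := by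
    rw [tendsto_zero_iff_norm_tendsto_zero]
    refine squeeze_zero (fun _ => norm_nonneg _) (fun n => ?_)
      tendsto_one_div_add_atTop_nhds_zero_nat
    rw [← dist_eq_norm]
    exact (hdist n).le
  refine ⟨z, hz, hlim, fun y => ?_, C + ‖a‖ + 1, fun n => ?_⟩
  · have h1 := (h.sub_const a y).sub (weaklyTendsto_of_tendsto hlim y)
    simpa [inner_sub_left] using h1
  · have h1 : ‖z n‖ ≤ ‖w n - a‖ + ‖w n - a - z n‖ := by
      have := norm_sub_le (w n - a) (w n - a - z n)
      rwa [sub_sub_cancel] at this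
    have h2 := (norm_sub_le (w n) a)
    have h3 := hdist n
    rw [dist_eq_norm] at h3
    have h4 : 1 / ((n : ℝ) + 1) ≤ 1 := by
      rw [div_le_one (by positivity)]; linarith [n.cast_nonneg (α := ℝ)]
    linarith [hC n]

/-- Weak lower semicontinuity of `∑ ‖·‖²`, along sequences on which the sum converges. -/
theorem sum_norm_sq_le_of_weaklyTendsto {ι : Type*} [Fintype ι] {x : ℕ → ι → X} {a : ι → X}
    (h : ∀ i, WeaklyTendsto (fun n => x n i) (a i)) {e : ℝ}
    (he : Tendsto (fun n => ∑ i, ‖x n i‖ ^ 2) atTop (𝓝 e)) : ∑ i, ‖a i‖ ^ 2 ≤ e := by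
  have h1 : Tendsto (fun n => ∑ i, inner ℝ (x n i) (a i)) atTop (𝓝 (∑ i, ‖a i‖ ^ 2)) := by
    have := tendsto_finsetSum Finset.univ fun i _ => h i (a i)
    simpa only [real_inner_self_eq_norm_sq] using this
  have h2 : ∑ i, ‖a i‖ ^ 2 ≤ (e + ∑ i, ‖a i‖ ^ 2) / 2 := by
    refine le_of_tendsto_of_tendsto' h1 ((he.add_const _).div_const 2) fun n => ?_
    rw [← Finset.sum_add_distrib, Finset.sum_div]
    refine Finset.sum_le_sum fun i _ => ?_
    nlinarith [real_inner_le_norm (x n i) (a i), sq_nonneg (‖x n i‖ - ‖a i‖)]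
  linarith

end WeakConvergence

/-! ### The Sobolev space `H¹(Ω)` -/

section SobolevSpace

open Filter Topology

/-- Integration against a square integrable function is an inner product in `L²`. -/
theorem integral_inner_eq_inner_toLp {α F : Type*} [MeasurableSpace α] {μ : Measure α}
    [NormedAddCommGroup F] [InnerProductSpace ℝ F] (u : Lp F 2 μ) {h : α → F}
    (hh : MemLp h 2 μ) : ∫ x, inner ℝ (u x) (h x) ∂μ = inner ℝ u (hh.toLp h) := by
  rw [L2.inner_def]
  refine integral_congr_ae ?_
  filter_upwards [hh.coeFn_toLp] with x hx
  rw [hx]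

theorem integral_mul_eq_inner_toLp {α : Type*} [MeasurableSpace α] {μ : Measure α}
    (u : Lp ℝ 2 μ) {h : α → ℝ} (hh : MemLp h 2 μ) :
    ∫ x, u x * h x ∂μ = inner ℝ u (hh.toLp h) := by
  rw [← integral_inner_eq_inner_toLp]
  simp [mul_comm]

theorem norm_sq_eq_integral {α F : Type*} [MeasurableSpace α] {μ : Measure α}
    [NormedAddCommGroup F] [InnerProductSpace ℝ F] (u : Lp F 2 μ) :
    ‖u‖ ^ 2 = ∫ x, ‖u x‖ ^ 2 ∂μ := by
  rw [← real_inner_self_eq_norm_sq, L2.inner_def]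
  simp only [real_inner_self_eq_norm_sq]

theorem setIntegral_eq_integral_of_ae_eq {α : Type*} [MeasurableSpace α] {μ : Measure α}
    {s : Set α} {f g : α → ℝ} (hfg : f =ᵐ[μ.restrict s] g) (hg : ∀ x, x ∉ s → g x = 0) :
    ∫ x in s, f x ∂μ = ∫ x, g x ∂μ :=
  (integral_congr_ae hfg).trans (setIntegral_eq_integral_of_forall_compl_eq_zero hg)

variable {d : ℕ} {Ω : Set (EuclideanSpace ℝ (Fin d))}

instance : SecondCountableTopology (H1 Ω) :=
  have : Fact ((2 : ENNReal) ≠ ⊤) := ⟨by simp⟩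
  have : SecondCountableTopology (Lp ℝ 2 (volume.restrict Ω)) := inferInstance
  have : SecondCountableTopology (Lp (EuclideanSpace ℝ (Fin d)) 2 (volume.restrict Ω)) :=
    inferInstance
  have : SecondCountableTopology (WithLp 2 (Lp ℝ 2 (volume.restrict Ω) ×
      Lp (EuclideanSpace ℝ (Fin d)) 2 (volume.restrict Ω))) :=
    WithLp.secondCountableTopology 2 _ _
  TopologicalSpace.Subtype.secondCountableTopology _

/-- The embedding `H¹(Ω) → L²(Ω)` as a continuous linear map. -/
def toL2L (Ω : Set (EuclideanSpace ℝ (Fin d))) : H1 Ω →L[ℝ] Lp ℝ 2 (volume.restrict Ω) :=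
  (WithLp.fstL 2 ℝ _ _).comp (H1 Ω).subtypeL

/-- The weak gradient `H¹(Ω) → L²(Ω; ℝ^d)` as a continuous linear map. -/
def weakGradL (Ω : Set (EuclideanSpace ℝ (Fin d))) :
    H1 Ω →L[ℝ] Lp (EuclideanSpace ℝ (Fin d)) 2 (volume.restrict Ω) :=
  (WithLp.sndL 2 ℝ _ _).comp (H1 Ω).subtypeL

theorem toL2L_apply (w : H1 Ω) : toL2L Ω w = toL2 w := rfl

theorem toL2_sub (u v : H1 Ω) : toL2 (u - v) = toL2 u - toL2 v := rfl

theorem weakGrad_sub (u v : H1 Ω) : weakGrad (u - v) = weakGrad u - weakGrad v := rfl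

theorem toL2_zero : toL2 (0 : H1 Ω) = 0 := rfl

theorem norm_sq_eq (w : H1 Ω) : ‖w‖ ^ 2 = ‖toL2 w‖ ^ 2 + ‖weakGrad w‖ ^ 2 :=
  WithLp.prod_norm_sq_eq_of_L2 _

theorem norm_toL2_le (w : H1 Ω) : ‖toL2 w‖ ≤ ‖w‖ := by
  have := norm_sq_eq w
  exact abs_le_of_sq_le_sq' (by nlinarith [sq_nonneg ‖weakGrad w‖]) (norm_nonneg _) |>.2

theorem norm_weakGrad_le (w : H1 Ω) : ‖weakGrad w‖ ≤ ‖w‖ := by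
  have := norm_sq_eq w
  exact abs_le_of_sq_le_sq' (by nlinarith [sq_nonneg ‖toL2 w‖]) (norm_nonneg _) |>.2

theorem hasWeakGradient (w : H1 Ω) : HasWeakGradient Ω (toL2 w) (weakGrad w) := w.2

/-- `H¹(Ω)` is cut out of `L² × L²` by continuous linear equations. -/
theorem isClosed_H1 (Ω : Set (EuclideanSpace ℝ (Fin d))) : IsClosed (H1 Ω : Set (WithLp 2
    (Lp ℝ 2 (volume.restrict Ω) × Lp (EuclideanSpace ℝ (Fin d)) 2 (volume.restrict Ω)))) := by
  have : (H1 Ω : Set (WithLp 2 (Lp ℝ 2 (volume.restrict Ω) ×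
      Lp (EuclideanSpace ℝ (Fin d)) 2 (volume.restrict Ω)))) =
      ⋂ (ψ) (_ : IsTestFunction Ω ψ) (v : EuclideanSpace ℝ (Fin d)),
        {w | ∫ x in Ω, w.fst x * fderiv ℝ ψ x v = - ∫ x in Ω, inner ℝ (w.snd x) v * ψ x} := by
    ext w; simp [H1, HasWeakGradient]
  rw [this]
  refine isClosed_iInter fun ψ => isClosed_iInter fun hψ => isClosed_iInter fun v => ?_
  have hv : MemLp (fun x => ψ x • v) 2 (volume.restrict Ω) :=
    ((ContinuousLinearMap.id ℝ ℝ).smulRight v).comp_memLp' hψ.memLp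
  refine isClosed_eq ?_ (Continuous.neg ?_)
  · simp only [fun w : WithLp 2 (Lp ℝ 2 (volume.restrict Ω) ×
      Lp (EuclideanSpace ℝ (Fin d)) 2 (volume.restrict Ω)) =>
        integral_mul_eq_inner_toLp w.fst (hψ.memLp_fderiv v)]
    exact ((WithLp.fstL 2 ℝ _ _).continuous).inner continuous_const
  · have h2 : ∀ w : WithLp 2 (Lp ℝ 2 (volume.restrict Ω) ×
      Lp (EuclideanSpace ℝ (Fin d)) 2 (volume.restrict Ω)),
        ∫ x in Ω, inner ℝ (w.snd x) v * ψ x = inner ℝ w.snd (hv.toLp _) := fun w => by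
      rw [← integral_inner_eq_inner_toLp]
      simp [inner_smul_right, mul_comm]
    simp only [h2]
    exact ((WithLp.sndL 2 ℝ _ _).continuous).inner continuous_const

instance : CompleteSpace (H1 Ω) := (isClosed_H1 Ω).completeSpace_coe

theorem WeaklyTendsto.toL2 {w : ℕ → H1 Ω} {a : H1 Ω} (h : WeaklyTendsto w a) :
    WeaklyTendsto (fun n => toL2 (w n)) (toL2 a) :=
  h.map (toL2L Ω)

theorem WeaklyTendsto.weakGrad {w : ℕ → H1 Ω} {a : H1 Ω} (h : WeaklyTendsto w a) :
    WeaklyTendsto (fun n => weakGrad (w n)) (weakGrad a) :=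
  h.map (weakGradL Ω)

/-- An element of `H¹(Ω)` is determined by its function: the weak gradient is unique. -/
theorem toL2_injective (hΩ : IsOpen Ω) : Function.Injective (toL2 : H1 Ω → _) := by
  change Function.Injective (toL2L Ω)
  rw [injective_iff_map_eq_zero]
  intro w hw
  rw [toL2L_apply] at hw
  have hloc : LocallyIntegrable (weakGrad w) (volume.restrict Ω) :=
    (Lp.memLp (weakGrad w)).locallyIntegrable (by norm_num)
  have hg : weakGrad w = 0 := by
    rw [Lp.eq_zero_iff_ae_eq_zero]
    have := hΩ.ae_eq_zero_of_integral_contDiff_smul_eq_zero (μ := volume.restrict Ω)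
      (hloc.locallyIntegrableOn Ω) fun ψ h1 h2 h3 => ?_
    · filter_upwards [this, ae_restrict_mem hΩ.measurableSet] with x hx hxΩ using hx hxΩ
    have hψ : IsTestFunction Ω ψ := ⟨h1, h2, h3⟩
    have hint : Integrable (fun x => ψ x • weakGrad w x) (volume.restrict Ω) :=
      memLp_one_iff_integrable.1 ((Lp.memLp (weakGrad w)).smul hψ.memLp)
    refine ext_inner_right ℝ fun v => ?_
    rw [inner_zero_left, real_inner_comm, ← integral_inner hint v]
    have h0 := hasWeakGradient w ψ hψ v
    have hz : ∫ x in Ω, toL2 w x * fderiv ℝ ψ x v = 0 := by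
      rw [hw]
      refine integral_eq_zero_of_ae ?_
      filter_upwards [Lp.coeFn_zero ℝ 2 (volume.restrict Ω)] with x hx
      rw [hx, Pi.zero_apply, zero_mul]
    rw [hz] at h0
    rw [← neg_eq_zero, h0]
    simp [inner_smul_right, real_inner_comm, mul_comm]
  have := norm_sq_eq w
  rw [hw, hg] at this
  simpa using this

/-- A Lipschitz function on a bounded open set belongs to `H¹`, its weak gradient being its almost
everywhere gradient. -/
theorem exists_H1_of_lipschitz (hΩ : IsOpen Ω) (hb : Bornology.IsBounded Ω)
    {f : EuclideanSpace ℝ (Fin d) → ℝ} {K : ℝ≥0} (hf : LipschitzWith K f) :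
    ∃ w : H1 Ω, toL2 w =ᵐ[volume.restrict Ω] f ∧
      weakGrad w =ᵐ[volume.restrict Ω] gradient f := by
  have hfin : Fact (volume Ω < ⊤) := ⟨hb.measure_lt_top⟩
  have hfm : MemLp f 2 (volume.restrict Ω) := by
    obtain ⟨C, hC⟩ := hb.isCompact_closure.exists_bound_of_continuousOn hf.continuous.continuousOn
    refine MemLp.of_bound hf.continuous.aestronglyMeasurable C ?_
    filter_upwards [ae_restrict_mem hΩ.measurableSet] with x hx using hC x (subset_closure hx)
  have hgm : MemLp (gradient f) 2 (volume.restrict Ω) := by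
    refine MemLp.of_bound (C := K) ?_ (ae_of_all _ fun x => ?_)
    · exact ((InnerProductSpace.toDual ℝ _).symm.continuous.measurable.comp
        (measurable_fderiv ℝ f)).aestronglyMeasurable
    · rw [gradient, LinearIsometryEquiv.norm_map]
      exact norm_fderiv_le_of_lipschitz ℝ hf
  have hw : HasWeakGradient Ω (hfm.toLp f) (hgm.toLp _) := by
    intro ψ hψ v
    obtain ⟨D, hD⟩ := hψ.1.lipschitzWith_of_hasCompactSupport hψ.2.1 (by simp)
    have hz : ∀ x, x ∉ Ω → ψ x = 0 := fun x hx =>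
      image_eq_zero_of_notMem_tsupport fun h => hx (hψ.2.2 h)
    have hz' : ∀ x, x ∉ Ω → fderiv ℝ ψ x = 0 := fun x hx =>
      image_eq_zero_of_notMem_tsupport fun h => hx (hψ.2.2 (tsupport_fderiv_subset ℝ h))
    have hl : ∫ x in Ω, hfm.toLp f x * fderiv ℝ ψ x v = ∫ x, fderiv ℝ ψ x v * f x := by
      refine setIntegral_eq_integral_of_ae_eq ?_ (fun x hx => by simp [hz' x hx])
      filter_upwards [hfm.coeFn_toLp] with x hx
      rw [hx, mul_comm]
    have hr : ∫ x in Ω, inner ℝ (hgm.toLp (gradient f) x) v * ψ x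
        = ∫ x, fderiv ℝ f x v * ψ x := by
      refine setIntegral_eq_integral_of_ae_eq ?_ (fun x hx => by simp [hz x hx])
      filter_upwards [hgm.coeFn_toLp] with x hx
      rw [hx, gradient, InnerProductSpace.toDual_symm_apply]
    rw [hl, hr, ← integral_neg]
    have key := LipschitzWith.integral_lineDeriv_mul_eq (μ := volume) hf hD hψ.2.1 (-v)
    rw [neg_neg] at key
    have e1 : ∫ x, lineDeriv ℝ ψ x v * f x = ∫ x, fderiv ℝ ψ x v * f x := by
      refine integral_congr_ae (ae_of_all _ fun x => ?_)
      simp only [(hψ.1.differentiable (by simp) x).lineDeriv_eq_fderiv]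
    rw [← e1, ← key]
    refine integral_congr_ae ?_
    filter_upwards [hf.ae_differentiableAt] with x hx
    rw [hx.lineDeriv_eq_fderiv]
    simp
  exact ⟨⟨WithLp.toLp 2 (hfm.toLp f, hgm.toLp _), hw⟩, hfm.coeFn_toLp, hgm.coeFn_toLp⟩

theorem norm_weakGrad_le_of_lipschitz (hb : Bornology.IsBounded Ω)
    {f : EuclideanSpace ℝ (Fin d) → ℝ} {K : ℝ≥0} (hf : LipschitzWith K f) {w : H1 Ω}
    (hw : weakGrad w =ᵐ[volume.restrict Ω] gradient f) :
    ‖weakGrad w‖ ^ 2 ≤ volume.real Ω * K ^ 2 := by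
  have hfin : Fact (volume Ω < ⊤) := ⟨hb.measure_lt_top⟩
  rw [norm_sq_eq_integral]
  calc _ ≤ ∫ x in Ω, (K : ℝ) ^ 2 := by
        refine integral_mono_of_nonneg (ae_of_all _ fun x => sq_nonneg _) (integrable_const _) ?_
        filter_upwards [hw] with x hx
        rw [hx, gradient, LinearIsometryEquiv.norm_map]
        gcongr
        exact norm_fderiv_le_of_lipschitz ℝ hf
    _ = _ := by simp

theorem IsTestFunction.lipschitz {ψ : EuclideanSpace ℝ (Fin d) → ℝ} (hψ : IsTestFunction Ω ψ) :
    ∃ K : ℝ≥0, LipschitzWith K ψ :=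
  hψ.1.lipschitzWith_of_hasCompactSupport hψ.2.1 (by simp)

theorem exists_H1_of_isTestFunction (hΩ : IsOpen Ω) (hb : Bornology.IsBounded Ω)
    {ψ : EuclideanSpace ℝ (Fin d) → ℝ} (hψ : IsTestFunction Ω ψ) :
    ∃ w : H1 Ω, toL2 w =ᵐ[volume.restrict Ω] ψ ∧
      weakGrad w =ᵐ[volume.restrict Ω] gradient ψ :=
  exists_H1_of_lipschitz hΩ hb hψ.lipschitz.choose_spec

theorem norm_toL2_sq_of_isTestFunction {w : H1 Ω} {ψ : EuclideanSpace ℝ (Fin d) → ℝ}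
    (hψ : IsTestFunction Ω ψ) (hw : toL2 w =ᵐ[volume.restrict Ω] ψ) :
    ‖toL2 w‖ ^ 2 = ∫ x, ψ x ^ 2 := by
  rw [norm_sq_eq_integral]
  refine setIntegral_eq_integral_of_ae_eq ?_ ?_
  · filter_upwards [hw] with x hx
    rw [hx]; simp
  · intro x hx
    rw [image_eq_zero_of_notMem_tsupport fun h => hx (hψ.2.2 h)]; simp

theorem norm_weakGrad_sq_of_isTestFunction (hΩ : IsOpen Ω) (hb : Bornology.IsBounded Ω)
    {w : H1 Ω} {ψ : EuclideanSpace ℝ (Fin d) → ℝ}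
    (hψ : IsTestFunction Ω ψ) (hw : toL2 w =ᵐ[volume.restrict Ω] ψ) :
    ‖weakGrad w‖ ^ 2 = ∫ x, ‖fderiv ℝ ψ x‖ ^ 2 := by
  obtain ⟨w', h1, h2⟩ := exists_H1_of_isTestFunction hΩ hb hψ
  obtain rfl : w = w' := toL2_injective hΩ (Lp.ext (hw.trans h1.symm))
  rw [norm_sq_eq_integral]
  refine setIntegral_eq_integral_of_ae_eq ?_ ?_
  · filter_upwards [h2] with x hx
    rw [hx, gradient, LinearIsometryEquiv.norm_map]
  · intro x hx
    rw [image_eq_zero_of_notMem_tsupport fun h => hx (hψ.2.2 (tsupport_fderiv_subset ℝ h))]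
    simp

end SobolevSpace

/-! ### The subspace `H¹₀(Ω)` -/

section ZeroTrace

open Filter Topology

variable {d : ℕ} {Ω : Set (EuclideanSpace ℝ (Fin d))}

/-- The test functions, as a subspace of `H¹(Ω)`. -/
def testSubmodule (Ω : Set (EuclideanSpace ℝ (Fin d))) : Submodule ℝ (H1 Ω) where
  carrier := {w : H1 Ω | ∃ ψ, IsTestFunction Ω ψ ∧ toL2 w =ᵐ[volume.restrict Ω] ψ}
  zero_mem' := ⟨0, ⟨contDiff_const, .zero, by simp [tsupport]⟩, Lp.coeFn_zero _ _ _⟩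
  add_mem' := by
    rintro a b ⟨f, hf, hfa⟩ ⟨g, hg, hgb⟩
    refine ⟨f + g, ⟨hf.1.add hg.1, hf.2.1.add hg.2.1,
      (tsupport_add f g).trans (Set.union_subset hf.2.2 hg.2.2)⟩, ?_⟩
    exact (Lp.coeFn_add (toL2 a) (toL2 b)).trans (hfa.add hgb)
  smul_mem' := by
    rintro c a ⟨f, hf, hfa⟩
    have hsub : tsupport (c • f) ⊆ tsupport f :=
      closure_mono (Function.support_const_smul_subset c f)
    refine ⟨c • f, ⟨hf.1.const_smul c, hf.2.1.mono' ((subset_tsupport _).trans hsub),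
      hsub.trans hf.2.2⟩, ?_⟩
    exact (Lp.coeFn_smul c (toL2 a)).trans (hfa.const_smul c)

/-- `H¹₀(Ω)` as a subspace of `H¹(Ω)`. -/
def H10Submodule (Ω : Set (EuclideanSpace ℝ (Fin d))) : Submodule ℝ (H1 Ω) :=
  (testSubmodule Ω).topologicalClosure

theorem mem_H10Submodule {w : H1 Ω} : w ∈ H10Submodule Ω ↔ w ∈ H10 Ω := Iff.rfl

theorem isClosed_H10Submodule : IsClosed (H10Submodule Ω : Set (H1 Ω)) :=
  Submodule.isClosed_topologicalClosure _

/-- **Poincaré's inequality** on `H¹₀` of a bounded open set. -/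
theorem exists_norm_le_of_mem_H10 (hd : 1 ≤ d) (hΩ : IsOpen Ω) (hb : Bornology.IsBounded Ω) :
    ∃ C : ℝ, 0 ≤ C ∧ ∀ w ∈ H10 Ω, ‖w‖ ≤ C * ‖weakGrad w‖ := by
  have : Nonempty (Fin d) := ⟨⟨0, hd⟩⟩
  obtain ⟨R, hR0, hR⟩ : ∃ R : ℝ, 0 ≤ R ∧ Ω ⊆ Metric.closedBall 0 R := by
    obtain ⟨R, hR⟩ := hb.subset_closedBall 0
    exact ⟨max R 0, le_max_right _ _, hR.trans (Metric.closedBall_subset_closedBall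
      (le_max_left _ _))⟩
  refine ⟨Real.sqrt ((2 * R + 1) ^ 2 + 1), Real.sqrt_nonneg _, fun w hw => ?_⟩
  refine closure_minimal (t := {w : H1 Ω | ‖w‖ ≤ Real.sqrt ((2 * R + 1) ^ 2 + 1) *
    ‖weakGradL Ω w‖}) ?_ (isClosed_le continuous_norm
    (continuous_const.mul (weakGradL Ω).continuous.norm)) hw
  rintro z ⟨ψ, hψ, hz⟩
  have h1 := norm_toL2_sq_of_isTestFunction hψ hz
  have h2 := norm_weakGrad_sq_of_isTestFunction hΩ hb hψ hz
  have h3 := integral_sq_le_of_tsupport_subset_ball (hψ.1.of_le (by simp)) hψ.2.1 hR0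
    (hψ.2.2.trans hR)
  rw [← h1, ← h2] at h3
  change ‖z‖ ≤ _ * ‖weakGrad z‖
  refine (sq_le_sq₀ (norm_nonneg _) (by positivity)).1 ?_
  rw [norm_sq_eq, mul_pow, Real.sq_sqrt (by positivity)]
  linarith

/-- **Rellich's theorem** for elements of `H¹(Ω)` given by test functions. -/
theorem tendsto_toL2_zero_of_mem_testSubmodule (hΩ : IsOpen Ω) (hb : Bornology.IsBounded Ω)
    {z : ℕ → H1 Ω} (hz : ∀ n, z n ∈ testSubmodule Ω) {C : ℝ} (hC : ∀ n, ‖z n‖ ≤ C)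
    (hzw : WeaklyTendsto z 0) : Tendsto (fun n => toL2 (z n)) atTop (𝓝 0) := by
  choose ψ hψ hzψ using hz
  have hC0 : ∀ n, ‖z n‖ ^ 2 ≤ C ^ 2 := fun n => pow_le_pow_left₀ (norm_nonneg _) (hC n) 2
  have key : Tendsto (fun n => ∫ x, ψ n x ^ 2) atTop (𝓝 0) := by
    refine tendsto_integral_sq_of_tendsto_ball (Ω := Ω) hb.measure_lt_top.ne
      (fun n => (hψ n).1.of_le (by simp)) (fun n => (hψ n).2.1) (fun n => (hψ n).2.2)
      (C := C ^ 2) (fun n => ?_) (fun n => ?_) (fun x ε => ?_)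
    · rw [← norm_toL2_sq_of_isTestFunction (hψ n) (hzψ n)]
      exact (pow_le_pow_left₀ (norm_nonneg _) (norm_toL2_le _) 2).trans (hC0 n)
    · rw [← norm_weakGrad_sq_of_isTestFunction hΩ hb (hψ n) (hzψ n)]
      exact (pow_le_pow_left₀ (norm_nonneg _) (norm_weakGrad_le _) 2).trans (hC0 n)
    · have hfin : Fact (volume Ω < ⊤) := ⟨hb.measure_lt_top⟩
      have hB : MemLp ((Metric.ball x ε).indicator fun _ => (1 : ℝ)) 2 (volume.restrict Ω) :=
        (memLp_const 1).indicator Metric.isOpen_ball.measurableSet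
      have := hzw.toL2 (hB.toLp _)
      rw [toL2_zero, inner_zero_left] at this
      refine this.congr fun n => ?_
      rw [← integral_mul_eq_inner_toLp, ← integral_indicator Metric.isOpen_ball.measurableSet]
      refine setIntegral_eq_integral_of_ae_eq ?_ ?_
      · filter_upwards [hzψ n] with y hy
        rw [hy]
        by_cases hyB : y ∈ Metric.ball x ε <;> simp [hyB]
      · intro y hy
        rw [Set.indicator_apply_eq_zero]
        exact fun _ => image_eq_zero_of_notMem_tsupport fun h => hy ((hψ n).2.2 h)
  rw [tendsto_zero_iff_norm_tendsto_zero]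
  have h1 := (Real.continuous_sqrt.tendsto _).comp key
  rw [Real.sqrt_zero] at h1
  refine h1.congr fun n => ?_
  rw [Function.comp_apply, ← norm_toL2_sq_of_isTestFunction (hψ n) (hzψ n),
    Real.sqrt_sq (norm_nonneg _)]

/-- **Rellich's theorem**: on `H¹₀` of a bounded open set, weak convergence in `H¹` implies strong
convergence in `L²`. -/
theorem tendsto_toL2_of_weaklyTendsto (hΩ : IsOpen Ω) (hb : Bornology.IsBounded Ω)
    {w : ℕ → H1 Ω} {a : H1 Ω} (hw : ∀ n, w n ∈ H10 Ω) {C : ℝ} (hC : ∀ n, ‖w n‖ ≤ C)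
    (ha : WeaklyTendsto w a) : Tendsto (fun n => toL2 (w n)) atTop (𝓝 (toL2 a)) := by
  obtain ⟨z, hz, hlim, hzw, C', hzb⟩ := ha.exists_approx (S := testSubmodule Ω) hw hC
  have hz0 := tendsto_toL2_zero_of_mem_testSubmodule hΩ hb hz hzb hzw
  have h1 : Tendsto (fun n => toL2 (w n - a - z n)) atTop (𝓝 0) :=
    squeeze_zero_norm (fun n => norm_toL2_le _) (tendsto_zero_iff_norm_tendsto_zero.1 hlim)
  have h2 := (h1.add hz0).add (tendsto_const_nhds (x := toL2 a))
  rw [zero_add, zero_add] at h2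
  refine h2.congr fun n => ?_
  rw [toL2_sub, toL2_sub]
  abel

end ZeroTrace

/-! ### Lipschitz functions vanishing on the boundary -/

section BoundaryValues

open Filter Topology

variable {d : ℕ} {Ω : Set (EuclideanSpace ℝ (Fin d))}

/-- Mollification: a Lipschitz function with compact support in `Ω` is a uniform limit of test
functions with the same Lipschitz constant. -/
theorem exists_isTestFunction_lipschitz_approx (hΩ : IsOpen Ω)
    {F : EuclideanSpace ℝ (Fin d) → ℝ} {K : ℝ≥0} (hF : LipschitzWith K F)
    (hFs : HasCompactSupport F) (hsub : tsupport F ⊆ Ω) {δ : ℝ} (hδ : 0 < δ) :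
    ∃ ψ, IsTestFunction Ω ψ ∧ LipschitzWith K ψ ∧ ∀ x, |ψ x - F x| ≤ δ := by
  obtain ⟨r₀, hr₀, hthick⟩ := hFs.isCompact.exists_cthickening_subset_open hΩ hsub
  set r := min r₀ (δ / (K + 1)) with hr
  have hrpos : 0 < r := lt_min hr₀ (by positivity)
  let φ : ContDiffBump (0 : EuclideanSpace ℝ (Fin d)) := ⟨r / 2, r, by positivity, by linarith⟩
  have hrOut : φ.rOut = r := rfl
  have hloc : LocallyIntegrable F volume := hF.continuous.locallyIntegrable
  set ψ : EuclideanSpace ℝ (Fin d) → ℝ :=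
    convolution (φ.normed volume) F (ContinuousLinearMap.lsmul ℝ ℝ) volume with hψ
  have hcx : ConvolutionExists (φ.normed volume) F (ContinuousLinearMap.lsmul ℝ ℝ) volume :=
    φ.hasCompactSupport_normed.convolutionExists_left _ φ.continuous_normed hloc
  have hts : tsupport ψ ⊆ Metric.cthickening r (tsupport F) := by
    refine closure_minimal ?_ Metric.isClosed_cthickening
    refine (support_convolution_subset (L := ContinuousLinearMap.lsmul ℝ ℝ)).trans ?_
    rintro _ ⟨a, ha, b, hb, rfl⟩
    rw [φ.support_normed_eq, mem_ball_zero_iff, hrOut] at ha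
    refine Metric.mem_cthickening_of_dist_le _ b _ _ (subset_tsupport F hb) ?_
    simpa [dist_eq_norm] using ha.le
  refine ⟨ψ, ⟨?_, ?_, ?_⟩, ?_, ?_⟩
  · exact φ.hasCompactSupport_normed.contDiff_convolution_left _ φ.contDiff_normed hloc
  · exact φ.hasCompactSupport_normed.convolution _ hFs
  · exact hts.trans ((Metric.cthickening_mono (min_le_left _ _) _).trans hthick)
  · refine LipschitzWith.of_dist_le_mul fun x y => ?_
    have hi := φ.integrable_normed (μ := volume)
    rw [Real.dist_eq, hψ, convolution_def, convolution_def,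
      ← integral_sub (hcx x) (hcx y)]
    calc _ ≤ ∫ t, φ.normed volume t * (K * dist x y) := by
          rw [← Real.norm_eq_abs]
          refine norm_integral_le_of_norm_le (hi.mul_const _) (ae_of_all _ fun t => ?_)
          simp only [ContinuousLinearMap.lsmul_apply, smul_eq_mul]
          rw [← mul_sub, norm_mul, Real.norm_of_nonneg (φ.nonneg_normed t)]
          refine mul_le_mul_of_nonneg_left ?_ (φ.nonneg_normed t)
          have := hF.dist_le_mul (x - t) (y - t)
          rwa [dist_sub_right, Real.dist_eq] at this
      _ = _ := by rw [integral_mul_const, φ.integral_normed, one_mul]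
  · intro x
    rw [← Real.dist_eq]
    refine φ.dist_normed_convolution_le hF.continuous.aestronglyMeasurable fun y hy => ?_
    rw [hrOut, Metric.mem_ball] at hy
    calc dist (F y) (F x) ≤ K * dist y x := hF.dist_le_mul _ _
      _ ≤ (K + 1) * (δ / (K + 1)) := by
          gcongr
          · linarith
          · exact hy.le.trans (min_le_right _ _)
      _ = δ := by field_simp

/-- A Lipschitz function vanishing on the boundary of a set stays Lipschitz when cut off to that
set: a segment leaving the set meets its boundary. -/
theorem lipschitzWith_indicator_of_eqOn_frontier {X : Type*} [NormedAddCommGroup X]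
    [NormedSpace ℝ X] {s : Set X} {f : X → ℝ} {K : ℝ≥0} (hf : LipschitzWith K f)
    (h0 : ∀ x ∈ frontier s, f x = 0) : LipschitzWith K (s.indicator f) := by
  have key : ∀ x ∈ s, ∀ y ∉ s, |f x| ≤ K * dist x y := by
    intro x hx y hy
    obtain ⟨z, hz, hzf⟩ : (segment ℝ x y ∩ frontier s).Nonempty := by
      by_contra hne
      have hcov : segment ℝ x y ⊆ interior s ∪ interior sᶜ := fun z hz => by
        rw [interior_compl]
        by_contra hz'
        rw [Set.mem_union, not_or, Set.notMem_compl_iff] at hz'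
        exact hne ⟨z, hz, hz'.2, hz'.1⟩
      have hxi : x ∈ interior s := (hcov (left_mem_segment ℝ x y)).resolve_right
        fun h => interior_subset h hx
      have hyi : y ∈ interior sᶜ := (hcov (right_mem_segment ℝ x y)).resolve_left
        fun h => hy (interior_subset h)
      obtain ⟨z, -, hz1, hz2⟩ := (convex_segment (𝕜 := ℝ) x y).isPreconnected _ _ isOpen_interior
        isOpen_interior hcov ⟨x, left_mem_segment ℝ x y, hxi⟩ ⟨y, right_mem_segment ℝ x y, hyi⟩
      exact interior_subset hz2 (interior_subset hz1)
    have h1 := hf.dist_le_mul x z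
    rw [h0 z hzf, Real.dist_eq, sub_zero] at h1
    have h2 := dist_add_dist_of_mem_segment hz
    refine h1.trans (mul_le_mul_of_nonneg_left ?_ K.2)
    linarith [dist_nonneg (x := z) (y := y)]
  refine LipschitzWith.of_dist_le_mul fun x y => ?_
  by_cases hx : x ∈ s <;> by_cases hy : y ∈ s <;>
    simp only [Set.indicator, hx, hy, if_true, if_false]
  · exact hf.dist_le_mul x y
  · simpa [Real.dist_eq] using key x hx y hy
  · rw [dist_comm x y]
    simpa [Real.dist_eq] using key y hy x hx
  · simpa using mul_nonneg K.2 dist_nonneg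

/-- Soft thresholding at height `ε`: the truncation of `t` to `[-ε, ε]` is subtracted from `t`. -/
def softThreshold (ε t : ℝ) : ℝ := t - max (-ε) (min ε t)

theorem lipschitzWith_softThreshold (ε : ℝ) : LipschitzWith 1 (softThreshold ε) := by
  refine LipschitzWith.of_dist_le_mul fun s t => ?_
  rw [NNReal.coe_one, one_mul, Real.dist_eq, Real.dist_eq]
  wlog hst : s ≤ t generalizing s t
  · rw [abs_sub_comm, abs_sub_comm s]; exact this t s (le_of_not_ge hst)
  rw [abs_sub_comm, abs_sub_comm s, abs_of_nonneg (sub_nonneg.2 hst), abs_le]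
  simp only [softThreshold]
  constructor <;> rcases max_cases (-ε) (min ε s) with h1 | h1 <;>
    rcases max_cases (-ε) (min ε t) with h2 | h2 <;> rcases min_cases ε s with h3 | h3 <;>
    rcases min_cases ε t with h4 | h4 <;> linarith

theorem abs_softThreshold_sub_le {ε : ℝ} (hε : 0 ≤ ε) (t : ℝ) : |softThreshold ε t - t| ≤ ε := by
  rw [softThreshold, sub_sub_cancel_left, abs_neg, abs_le]
  exact ⟨le_max_left _ _, max_le (by linarith) (min_le_left _ _)⟩

theorem softThreshold_of_abs_le {ε t : ℝ} (ht : |t| ≤ ε) : softThreshold ε t = 0 := by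
  rw [abs_le] at ht
  rw [softThreshold, min_eq_right ht.2, max_eq_right ht.1, sub_self]

/-- A Lipschitz function vanishing on `∂Ω` is on `Ω` a uniform limit of uniformly Lipschitz test
functions: thresholding makes its support compact in `Ω`, and then it can be mollified. -/
theorem exists_isTestFunction_approx_of_eq_zero_frontier (hΩ : IsOpen Ω)
    (hb : Bornology.IsBounded Ω) {f : EuclideanSpace ℝ (Fin d) → ℝ} {K : ℝ≥0}
    (hf : LipschitzWith K f) (h0 : ∀ x ∈ frontier Ω, f x = 0) {δ : ℝ} (hδ : 0 < δ) :
    ∃ ψ, IsTestFunction Ω ψ ∧ LipschitzWith K ψ ∧ ∀ x ∈ Ω, |ψ x - f x| ≤ δ := by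
  -- Thresholding and mollification each cost `δ / 2`.
  set F : EuclideanSpace ℝ (Fin d) → ℝ := fun x => softThreshold (δ / 2) (Ω.indicator f x) with hF
  have hFl : LipschitzWith K F := by
    have := (lipschitzWith_softThreshold (δ / 2)).comp
      (lipschitzWith_indicator_of_eqOn_frontier hf h0)
    rwa [one_mul] at this
  have hts : tsupport F ⊆ closure Ω ∩ {x | δ / 2 ≤ |f x|} := by
    refine closure_minimal ?_ (isClosed_closure.inter
      (isClosed_le continuous_const hf.continuous.abs))
    intro x hx
    have hx' : ¬ |Ω.indicator f x| ≤ δ / 2 := fun h => hx (softThreshold_of_abs_le h)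
    have hxΩ : x ∈ Ω := by
      by_contra h
      exact hx' (by simpa [h] using (half_pos hδ).le)
    rw [Set.indicator_of_mem hxΩ] at hx'
    exact ⟨subset_closure hxΩ, (not_le.1 hx').le⟩
  have hsub : tsupport F ⊆ Ω := by
    intro x hx
    by_contra hxΩ
    have hxf : x ∈ frontier Ω := by
      rw [hΩ.frontier_eq]; exact ⟨(hts hx).1, hxΩ⟩
    have := (hts hx).2
    rw [Set.mem_ofPred_eq, h0 x hxf, abs_zero] at this
    linarith
  have hFs : HasCompactSupport F :=
    hb.isCompact_closure.of_isClosed_subset (isClosed_tsupport F) fun x hx => (hts hx).1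
  obtain ⟨ψ, h1, h2, h3⟩ := exists_isTestFunction_lipschitz_approx hΩ hFl hFs hsub (half_pos hδ)
  refine ⟨ψ, h1, h2, fun x hx => ?_⟩
  have h4 := abs_softThreshold_sub_le (half_pos hδ).le (Ω.indicator f x)
  rw [Set.indicator_of_mem hx] at h4
  have h5 := h3 x
  simp only [hF, Set.indicator_of_mem hx] at h5
  linarith [abs_sub_le (ψ x) (softThreshold (δ / 2) (f x)) (f x)]

/-- A Lipschitz function vanishing on `∂Ω` belongs to `H¹₀(Ω)`. Approximating test functions are
bounded in `H¹`, so that a subsequence converges weakly, and closed subspaces are weakly closed. -/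
theorem mem_H10_of_lipschitz (hΩ : IsOpen Ω) (hb : Bornology.IsBounded Ω)
    {f : EuclideanSpace ℝ (Fin d) → ℝ} {K : ℝ≥0} (hf : LipschitzWith K f)
    (h0 : ∀ x ∈ frontier Ω, f x = 0) {w : H1 Ω} (hw : toL2 w =ᵐ[volume.restrict Ω] f) :
    w ∈ H10 Ω := by
  have hfin : Fact (volume Ω < ⊤) := ⟨hb.measure_lt_top⟩
  have happ : ∀ n : ℕ, ∃ z : H1 Ω, z ∈ testSubmodule Ω ∧ ‖weakGrad z‖ ^ 2 ≤ volume.real Ω * K ^ 2 ∧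
      ∀ᵐ x ∂volume.restrict Ω, |toL2 z x - f x| ≤ 1 / ((n : ℝ) + 1) := by
    intro n
    obtain ⟨ψ, h1, h2, h3⟩ := exists_isTestFunction_approx_of_eq_zero_frontier hΩ hb hf h0
      (δ := 1 / ((n : ℝ) + 1)) (by positivity)
    obtain ⟨z, hz, hz'⟩ := exists_H1_of_lipschitz hΩ hb h2
    refine ⟨z, ⟨ψ, h1, hz⟩, norm_weakGrad_le_of_lipschitz hb h2 hz', ?_⟩
    filter_upwards [hz, ae_restrict_mem hΩ.measurableSet] with x hx hxΩ
    rw [hx]; exact h3 x hxΩ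
  choose z hz hzg hzf using happ
  set c : ℝ := (measureUnivNNReal (volume.restrict Ω) : ℝ) ^ (ENNReal.toReal 2)⁻¹ with hc
  have hc0 : 0 ≤ c := by positivity
  have hdist : ∀ n : ℕ, ‖toL2 (z n) - toL2 w‖ ≤ c * (1 / ((n : ℝ) + 1)) := by
    intro n
    refine Lp.norm_le_of_ae_bound (by positivity) ?_
    filter_upwards [hzf n, hw, Lp.coeFn_sub (toL2 (z n)) (toL2 w)] with x hx hwx hs
    rw [hs, Pi.sub_apply, hwx]; exact hx
  have hlim : Tendsto (fun n => toL2 (z n)) atTop (𝓝 (toL2 w)) := by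
    rw [tendsto_iff_norm_sub_tendsto_zero]
    refine squeeze_zero (fun _ => norm_nonneg _) hdist ?_
    simpa using (tendsto_one_div_add_atTop_nhds_zero_nat (𝕜 := ℝ)).const_mul c
  have hbd : ∀ n, ‖z n‖ ≤ Real.sqrt ((‖toL2 w‖ + c) ^ 2 + volume.real Ω * K ^ 2) := by
    intro n
    refine Real.le_sqrt_of_sq_le ?_
    rw [norm_sq_eq]
    refine add_le_add (pow_le_pow_left₀ (norm_nonneg _) ?_ 2) (hzg n)
    have h1 : 1 / ((n : ℝ) + 1) ≤ 1 := by
      rw [div_le_one (by positivity)]; linarith [n.cast_nonneg (α := ℝ)]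
    have h2 := norm_le_norm_add_norm_sub' (toL2 (z n)) (toL2 w)
    have h3 := mul_le_mul_of_nonneg_left h1 hc0
    linarith [hdist n]
  obtain ⟨a, k, hk, ha⟩ := exists_subseq_weaklyTendsto hbd
  have haH : a ∈ H10Submodule Ω := ha.mem_of_isClosed isClosed_H10Submodule
    fun n => (testSubmodule Ω).le_topologicalClosure (hz (k n))
  have : toL2 a = toL2 w :=
    ha.toL2.unique (weaklyTendsto_of_tendsto (hlim.comp hk.tendsto_atTop))
  rw [← toL2_injective hΩ this]
  exact haH

/-- The boundary condition may be tested with any Lipschitz extension of the boundary data. -/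
theorem HasBoundaryValues.sub_mem_H10 (hΩ : IsOpen Ω) (hb : Bornology.IsBounded Ω)
    {u : H1 Ω} {φ : EuclideanSpace ℝ (Fin d) → ℝ} (hu : HasBoundaryValues Ω u φ)
    {Φ : EuclideanSpace ℝ (Fin d) → ℝ} {K : ℝ≥0} (hΦ : LipschitzWith K Φ)
    (hφ : Set.EqOn Φ φ (frontier Ω)) {b : H1 Ω} (hbΦ : toL2 b =ᵐ[volume.restrict Ω] Φ) :
    u - b ∈ H10 Ω := by
  obtain ⟨Φ', ⟨K', hΦ'⟩, hφ', w, hw, hwu⟩ := hu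
  have hmem : u - b - w ∈ H10 Ω := by
    refine mem_H10_of_lipschitz hΩ hb (hΦ'.sub hΦ) (fun x hx => ?_) ?_
    · simp [hφ hx, hφ' hx]
    · filter_upwards [Lp.coeFn_sub (toL2 u - toL2 b) (toL2 w), Lp.coeFn_sub (toL2 u) (toL2 b), hwu,
        hbΦ] with x h1 h2 h3 h4
      rw [toL2_sub, toL2_sub, h1, Pi.sub_apply, h2, Pi.sub_apply, h3, h4]
      ring
  have := (H10Submodule Ω).add_mem (mem_H10Submodule.2 hmem) (mem_H10Submodule.2 hw)
  rwa [sub_add_cancel] at this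

end BoundaryValues

/-! ### Existence of minimizers -/

section Existence

open Filter Topology

/-- Subsequences can be extracted for finitely many properties at once, if each of them passes to
further subsequences. -/
theorem exists_common_subseq {ι : Type*} [Finite ι] {P : ι → (ℕ → ℕ) → Prop}
    (hP : ∀ i (k l : ℕ → ℕ), P i k → StrictMono l → P i (k ∘ l))
    (hex : ∀ i (k : ℕ → ℕ), StrictMono k → ∃ l : ℕ → ℕ, StrictMono l ∧ P i (k ∘ l)) :
    ∃ k : ℕ → ℕ, StrictMono k ∧ ∀ i, P i k := by
  classical
  have := Fintype.ofFinite ι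
  suffices ∀ s : Finset ι, ∃ k : ℕ → ℕ, StrictMono k ∧ ∀ i ∈ s, P i k by
    simpa using this Finset.univ
  intro s
  induction s using Finset.induction_on with
  | empty => exact ⟨id, strictMono_id, by simp⟩
  | insert a s _ ih =>
    obtain ⟨k, hk, hkP⟩ := ih
    obtain ⟨l, hl, hlP⟩ := hex a k hk
    refine ⟨k ∘ l, hk.comp hl, fun i hi => ?_⟩
    rcases Finset.mem_insert.1 hi with rfl | hi
    · exact hlP
    · exact hP i k l (hkP i hi) hl

theorem exists_subseq_weaklyTendsto_pi {ι X : Type*} [Finite ι] [NormedAddCommGroup X]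
    [InnerProductSpace ℝ X] [CompleteSpace X] [TopologicalSpace.SeparableSpace X]
    {x : ℕ → ι → X} {C : ι → ℝ} (hx : ∀ n i, ‖x n i‖ ≤ C i) :
    ∃ a : ι → X, ∃ k : ℕ → ℕ, StrictMono k ∧ ∀ i, WeaklyTendsto (fun n => x (k n) i) (a i) := by
  obtain ⟨k, hk, h⟩ := exists_common_subseq
    (P := fun i k => ∃ a, WeaklyTendsto (fun n => x (k n) i) a)
    (fun i k l ⟨a, ha⟩ hl => ⟨a, ha.comp hl⟩)
    (fun i k _ => by
      obtain ⟨a, l, hl, ha⟩ := exists_subseq_weaklyTendsto (x := fun n => x (k n) i)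
        (fun n => hx (k n) i)
      exact ⟨l, hl, a, ha⟩)
  choose a ha using h
  exact ⟨a, k, hk, ha⟩

theorem exists_subseq_ae_tendsto {ι α : Type*} [Finite ι] [MeasurableSpace α] {μ : Measure α}
    {f : ℕ → ι → Lp ℝ 2 μ} {g : ι → Lp ℝ 2 μ}
    (h : ∀ i, Tendsto (fun n => f n i) atTop (𝓝 (g i))) :
    ∃ k : ℕ → ℕ, StrictMono k ∧
      ∀ᵐ x ∂μ, ∀ i, Tendsto (fun n => f (k n) i x) atTop (𝓝 (g i x)) := by
  obtain ⟨k, hk, h⟩ := exists_common_subseq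
    (P := fun i k => ∀ᵐ x ∂μ, Tendsto (fun n => f (k n) i x) atTop (𝓝 (g i x)))
    (fun i k l hP hl => hP.mono fun x hx => hx.comp hl.tendsto_atTop)
    (fun i k hk => (tendstoInMeasure_of_tendsto_Lp
      ((h i).comp hk.tendsto_atTop)).exists_seq_tendsto_ae)
  exact ⟨k, hk, ae_all_iff.2 h⟩

variable {d m : ℕ} {Ω : Set (EuclideanSpace ℝ (Fin d))}

theorem dirichletEnergy_eq_sum (U : Fin m → H1 Ω) :
    dirichletEnergy Ω U = ∑ i, ‖weakGrad (U i)‖ ^ 2 := by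
  rw [dirichletEnergy, integral_finsetSum]
  · simp only [norm_sq_eq_integral]
  · exact fun i _ => (Lp.memLp (weakGrad (U i))).integrable_norm_pow (by norm_num)

/-- Nonnegative `C^{1,α}` boundary data have nonnegative Lipschitz extensions. -/
theorem IsC1HolderBoundaryData.exists_lipschitz (hb : Bornology.IsBounded Ω) {α : ℝ≥0}
    {φ : EuclideanSpace ℝ (Fin d) → ℝ} (hφ : IsC1HolderBoundaryData Ω α φ)
    (h0 : ∀ x ∈ frontier Ω, 0 ≤ φ x) :
    ∃ Φ : EuclideanSpace ℝ (Fin d) → ℝ, (∃ K : ℝ≥0, LipschitzWith K Φ) ∧ (∀ x, 0 ≤ Φ x) ∧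
      Set.EqOn Φ φ (frontier Ω) := by
  obtain ⟨Ψ, hΨ, -, heq⟩ := hφ
  obtain ⟨R, hR⟩ := hb.closure.subset_closedBall 0
  obtain ⟨C, hC⟩ := (isCompact_closedBall (0 : EuclideanSpace ℝ (Fin d))
    R).exists_bound_of_continuousOn (hΨ.continuous_fderiv (by simp)).continuousOn
  have hl : LipschitzOnWith C.toNNReal Ψ (Metric.closedBall 0 R) :=
    (convex_closedBall _ _).lipschitzOnWith_of_nnnorm_fderiv_le
      (fun x _ => hΨ.differentiable one_ne_zero x)
      (fun x hx => by
        rw [← NNReal.coe_le_coe, coe_nnnorm]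
        exact (hC x hx).trans (Real.le_coe_toNNReal C))
  obtain ⟨g, hg, hgΨ⟩ := hl.extend_real
  refine ⟨fun x => max (g x) 0, ⟨_, hg.max_const 0⟩, fun x => le_max_right _ _, fun x hx => ?_⟩
  have hxR := hR (frontier_subset_closure hx)
  simp only [← hgΨ hxR, heq hx, max_eq_left (h0 x hx)]

theorem exists_lipschitzWith_inf' {ι X : Type*} [PseudoEMetricSpace X] {s : Finset ι}
    (hs : s.Nonempty) {Φ : ι → X → ℝ} (h : ∀ i, ∃ K : ℝ≥0, LipschitzWith K (Φ i)) :
    ∃ K : ℝ≥0, LipschitzWith K (fun x => s.inf' hs fun i => Φ i x) := by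
  induction hs using Finset.Nonempty.cons_induction with
  | singleton a => simpa using h a
  | cons a s ha hs ih =>
    obtain ⟨K, hK⟩ := h a
    obtain ⟨L, hL⟩ := ih
    refine ⟨max K L, ?_⟩
    simp only [Finset.inf'_cons hs]
    exact hK.min hL

/-- Subtracting the pointwise minimum from nonnegative extensions of the boundary data gives an
admissible competitor: the minimum is nonnegative and vanishes on `∂Ω`. -/
theorem constraintSet_nonempty (hm : 1 ≤ m) (hΩ : IsOpen Ω) (hb : Bornology.IsBounded Ω)
    {φ Φ : Fin m → EuclideanSpace ℝ (Fin d) → ℝ}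
    (hφ_prod : ∀ x ∈ frontier Ω, ∏ i, φ i x = 0)
    (hΦ : ∀ i, ∃ K : ℝ≥0, LipschitzWith K (Φ i)) (hΦ0 : ∀ i x, 0 ≤ Φ i x)
    (hΦφ : ∀ i, Set.EqOn (Φ i) (φ i) (frontier Ω)) : (constraintSet Ω φ).Nonempty := by
  have : Nonempty (Fin m) := ⟨⟨0, hm⟩⟩
  have hne : (Finset.univ : Finset (Fin m)).Nonempty := Finset.univ_nonempty
  set μ : EuclideanSpace ℝ (Fin d) → ℝ := fun x => Finset.univ.inf' hne fun i => Φ i x with hμ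
  have hμle : ∀ i x, μ x ≤ Φ i x := fun i x => Finset.inf'_le _ (Finset.mem_univ i)
  obtain ⟨L, hL⟩ : ∃ L : ℝ≥0, LipschitzWith L μ := exists_lipschitzWith_inf' hne hΦ
  have hμ0 : ∀ x ∈ frontier Ω, μ x = 0 := fun x hx => by
    obtain ⟨i, -, hi⟩ := Finset.prod_eq_zero_iff.1 (hφ_prod x hx)
    refine le_antisymm ?_ (Finset.le_inf' _ _ fun j _ => hΦ0 j x)
    rw [← hi, ← hΦφ i hx]
    exact hμle i x
  choose K hK using hΦ
  choose U hU _ using fun i => exists_H1_of_lipschitz hΩ hb ((hK i).sub hL)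
  refine ⟨U, fun i => ?_, ?_, fun i => ?_⟩
  · filter_upwards [hU i] with x hx
    rw [hx]
    exact sub_nonneg.2 (hμle i x)
  · filter_upwards [ae_all_iff.2 hU] with x hx
    obtain ⟨i, -, hi⟩ := Finset.exists_mem_eq_inf' hne fun i => Φ i x
    refine Finset.prod_eq_zero (Finset.mem_univ i) ?_
    rw [hx i]
    exact sub_eq_zero.2 hi.symm
  · refine ⟨fun x => Φ i x - μ x, ⟨_, (hK i).sub hL⟩, fun x hx => ?_, 0,
      (H10Submodule Ω).zero_mem, ?_⟩
    · simp only [hμ0 x hx, sub_zero, hΦφ i hx]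
    · filter_upwards [hU i, Lp.coeFn_zero ℝ 2 (volume.restrict Ω)] with x hx h0
      rw [toL2_zero, h0, hx]
      simp

/-- The sign condition and the segregation condition survive strong `L²` limits, through almost
everywhere convergence of a subsequence. -/
theorem nonneg_and_prod_eq_zero_of_tendsto {ι α : Type*} [Fintype ι] [MeasurableSpace α]
    {μ : Measure α} {f : ℕ → ι → Lp ℝ 2 μ} {g : ι → Lp ℝ 2 μ}
    (h : ∀ i, Tendsto (fun n => f n i) atTop (𝓝 (g i)))
    (hf0 : ∀ n i, ∀ᵐ x ∂μ, 0 ≤ f n i x) (hf : ∀ n, ∀ᵐ x ∂μ, ∏ i, f n i x = 0) :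
    (∀ i, ∀ᵐ x ∂μ, 0 ≤ g i x) ∧ ∀ᵐ x ∂μ, ∏ i, g i x = 0 := by
  obtain ⟨k, -, hk⟩ := exists_subseq_ae_tendsto h
  refine ⟨fun i => ?_, ?_⟩
  · filter_upwards [hk, ae_all_iff.2 fun n => hf0 n i] with x hx h0
    exact ge_of_tendsto' (hx i) fun n => h0 (k n)
  · filter_upwards [hk, ae_all_iff.2 hf] with x hx h0
    have := tendsto_finsetProd Finset.univ fun i _ => hx i
    simp only [h0] at this
    exact tendsto_nhds_unique this tendsto_const_nhds

/-- Sequences in the constraint set with convergent energy subconverge to an element of the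
constraint set of no larger energy. -/
theorem exists_mem_constraintSet_dirichletEnergy_le (hd : 1 ≤ d) (hΩ : IsOpen Ω)
    (hb : Bornology.IsBounded Ω) {φ Φ : Fin m → EuclideanSpace ℝ (Fin d) → ℝ}
    (hΦ : ∀ i, ∃ K : ℝ≥0, LipschitzWith K (Φ i))
    (hΦφ : ∀ i, Set.EqOn (Φ i) (φ i) (frontier Ω)) {U : ℕ → Fin m → H1 Ω}
    (hU : ∀ n, U n ∈ constraintSet Ω φ) {e : ℝ}
    (he : Tendsto (fun n => dirichletEnergy Ω (U n)) atTop (𝓝 e)) :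
    ∃ V ∈ constraintSet Ω φ, dirichletEnergy Ω V ≤ e := by
  choose K hK using hΦ
  choose b hbΦ _ using fun i => exists_H1_of_lipschitz hΩ hb (hK i)
  have hmem : ∀ n i, U n i - b i ∈ H10 Ω := fun n i =>
    ((hU n).2.2 i).sub_mem_H10 hΩ hb (hK i) (hΦφ i) (hbΦ i)
  obtain ⟨C, hC0, hC⟩ := exists_norm_le_of_mem_H10 hd hΩ hb
  obtain ⟨M, hM⟩ := he.bddAbove_range
  have hgrad : ∀ n i, ‖weakGrad (U n i)‖ ≤ Real.sqrt M := fun n i => by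
    refine Real.le_sqrt_of_sq_le (le_trans ?_ (hM ⟨n, rfl⟩))
    simp only [dirichletEnergy_eq_sum]
    exact Finset.single_le_sum (f := fun i => ‖weakGrad (U n i)‖ ^ 2)
      (fun j _ => sq_nonneg _) (Finset.mem_univ i)
  have hbd : ∀ n i, ‖U n i - b i‖ ≤ C * (Real.sqrt M + ‖weakGrad (b i)‖) := fun n i => by
    refine (hC _ (hmem n i)).trans (mul_le_mul_of_nonneg_left ?_ hC0)
    rw [weakGrad_sub]
    exact (norm_sub_le _ _).trans (add_le_add_left (hgrad n i) _)
  obtain ⟨a, k, hk, ha⟩ := exists_subseq_weaklyTendsto_pi (x := fun n i => U n i - b i) hbd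
  have haH : ∀ i, a i ∈ H10Submodule Ω := fun i =>
    (ha i).mem_of_isClosed isClosed_H10Submodule fun n => hmem (k n) i
  have hstrong : ∀ i, Tendsto (fun n => toL2 (U (k n) i)) atTop (𝓝 (toL2 (a i + b i))) :=
    fun i => by
      have := (tendsto_toL2_of_weaklyTendsto hΩ hb (fun n => hmem (k n) i)
        (fun n => hbd (k n) i) (ha i)).add_const (toL2 (b i))
      simp only [toL2_sub, sub_add_cancel] at this
      exact this
  have hweak : ∀ i, WeaklyTendsto (fun n => weakGrad (U (k n) i)) (weakGrad (a i + b i)) :=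
    fun i => by
      have := (ha i).weakGrad.sub_const (-weakGrad (b i))
      simp only [weakGrad_sub, sub_neg_eq_add, sub_add_cancel] at this
      exact this
  obtain ⟨h0, hprod⟩ := nonneg_and_prod_eq_zero_of_tendsto hstrong
    (fun n i => (hU (k n)).1 i) (fun n => (hU (k n)).2.1)
  refine ⟨fun i => a i + b i, ⟨h0, hprod, fun i => ⟨Φ i, ⟨K i, hK i⟩, hΦφ i, a i, haH i, ?_⟩⟩, ?_⟩
  · filter_upwards [hbΦ i, Lp.coeFn_add (toL2 (a i)) (toL2 (b i))] with x h1 h2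
    change _ = (toL2 (a i) + toL2 (b i) : Lp ℝ 2 (volume.restrict Ω)) x - _
    rw [h2, Pi.add_apply, h1, add_sub_cancel_right]
  · rw [dirichletEnergy_eq_sum]
    refine sum_norm_sq_le_of_weaklyTendsto hweak ?_
    simpa only [dirichletEnergy_eq_sum, Function.comp_def] using he.comp hk.tendsto_atTop

end Existence

end PartialSegregation

end

theorem mainTheorem3 (d m : ℕ) (hd : 1 ≤ d) (hm : 1 ≤ m)
    (Ω : Set (EuclideanSpace ℝ (Fin d)))
    (hΩ_open : IsOpen Ω) (hΩ_conn : IsConnected Ω) (hΩ_bdd : Bornology.IsBounded Ω)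
    (α : ℝ≥0) (hα_pos : 0 < α) (hα_le : α ≤ 1)
    (φ : Fin m → EuclideanSpace ℝ (Fin d) → ℝ)
    (hφ_reg : ∀ i, PartialSegregation.IsC1HolderBoundaryData Ω α (φ i))
    (hφ_nonneg : ∀ i, ∀ x ∈ frontier Ω, 0 ≤ φ i x)
    (hφ_prod : ∀ x ∈ frontier Ω, ∏ i, φ i x = 0) :
    ∃ U ∈ PartialSegregation.constraintSet Ω φ,
      ∀ V ∈ PartialSegregation.constraintSet Ω φ,
        PartialSegregation.dirichletEnergy Ω U ≤ PartialSegregation.dirichletEnergy Ω V := by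
  choose Φ hΦ hΦ0 hΦφ using fun i => (hφ_reg i).exists_lipschitz hΩ_bdd (hφ_nonneg i)
  set S := PartialSegregation.constraintSet Ω φ
  have hne : (PartialSegregation.dirichletEnergy Ω '' S).Nonempty :=
    (PartialSegregation.constraintSet_nonempty hm hΩ_open hΩ_bdd hφ_prod hΦ hΦ0 hΦφ).image _
  have hbb : BddBelow (PartialSegregation.dirichletEnergy Ω '' S) := by
    refine ⟨0, ?_⟩
    rintro _ ⟨U, -, rfl⟩
    rw [PartialSegregation.dirichletEnergy_eq_sum]
    positivity
  obtain ⟨e, -, he, hmem⟩ := exists_seq_tendsto_sInf hne hbb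
  choose U hU hUe using hmem
  obtain ⟨V, hV, hVe⟩ := PartialSegregation.exists_mem_constraintSet_dirichletEnergy_le hd hΩ_open
    hΩ_bdd hΦ hΦφ hU (e := sInf (PartialSegregation.dirichletEnergy Ω '' S))
    (by simpa only [hUe] using he)
  exact ⟨V, hV, fun W hW => hVe.trans (csInf_le hbb ⟨W, hW, rfl⟩)⟩
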